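/- Let $q>p>1$, let $p^*=p/(p-1)$, and consider on $(0,\infty)$ the measures $\mu(dx)=x^{-q/p^*-1}\,dx$ and $\nu(dx)=dx$. Let $$A=\sup\Big\{\frac{\|f\|_{L^q(\mu)}}{\|f'\|_{L^p(\nu)}}\Big\},$$ the supremum being over all $f$ on $[0,\infty)$ that are absolutely continuous on every $[0,b]$, with $f(0)=0$ and $0<\|f'\|_{L^p(\nu)}<\infty$. Put $$k_{q,p}=\left[\frac{\Gamma\big(\frac{pq}{q-p}\big)}{\Gamma\big(\frac{q}{q-p}\big)\Gamma\big(\frac{p(q-1)}{q-p}\big)}\right]^{1/p-1/q},\qquad \tilde k_{q,p}=\Big(1+\frac q{p^*}\Big)^{1/q}\Big(1+\frac{p^*}q\Big)^{1/p^*}.$$ Let $v$ be the density of $\nu$ with respect to Lebesgue measure, $\hat v=v^{1-p^*}$, $\varphi(x)=\int_0^x\hat v(y)\,dy$ (so here $v=\hat v=1$ and $\varphi(x)=x$), and $B=\sup_{x>0}\varphi(x)^{1/p^*}\mu(x,\infty)^{1/q}$. Define $f_1=\varphi^{\gamma^*}$ with $\gamma^*=\frac q{p^*+q}$ and, for $n\ge1$,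 $$f_{n+1}(x)=\int_0^x\hat v(y)\Big(\int_y^\infty f_n^{q/p^*}d\mu\Big)^{p^*/q}dy,\qquad \delta_n=\Big(\sup_{x>0}\frac{f_{n+1}(x)}{f_n(x)}\Big)^{1/p^*},$$ with the convention that $\delta_n=\infty$ for $n\ge 2$ if $\delta_1=\infty$. Finally let $$\bar\delta_1=\sup_{x_0\in(0,\infty]}\frac{\|\varphi(\cdot\wedge x_0)\|_{L^q(\mu)}}{\|\varphi(\cdot\wedge x_0)'\|_{L^p(\nu)}},$$ where those $x_0$ for which the quotient is $\infty/\infty$ (here only $x_0=\infty$) are disregarded. Then the following hold. 1. $A$ is the least constant $C\in[0,\infty]$ such that $\|f\|_{L^q(\mu)}\le C\,\|f'\|_{L^p(\nu)}$ for all $f$ on $[0,\infty)$ that are absolutely continuous on every $[0,b]$ and satisfy $f(0)=0$. Moreover $$A=\Big(\frac{p^*}q\Big)^{1/q}k_{q,p},\qquad B=\Big(\frac{p^*}q\Big)^{1/q},\qquad A=k_{q,p}B.$$ 2. The constant $A$ is attained: let $\gamma=\frac qp-1$. For all $\alpha,\beta>0$ the function $g(x)=\dfrac{\alpha x}{(1+\beta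 x^\gamma)^{1/\gamma}}$ is absolutely continuous on every $[0,b]$, $g(0)=0$, $g'(x)=\dfrac{\alpha}{(\beta x^\gamma+1)^{(\gamma+1)/\gamma}}$ for $x>0$, $0<\|g'\|_{L^p(\nu)}<\infty$, and $\|g\|_{L^q(\mu)}=A\,\|g'\|_{L^p(\nu)}$. 3. For every $n\ge1$, $$\delta_n=\Big(1+\frac{p^*}q\Big)^{1/p^*+1/q}=\tilde k_{q,p}B>k_{q,p}B .$$ Moreover, with $\tilde p=\frac q{p^*}+1$, let $\tilde A$ be the constant defined like $A$, with the same $\mu$ and $\nu$, but with both exponents $p$ and $q$ replaced by $\tilde p$. Then $\tilde A=\frac{p^*}q+1$ and $\delta_n=\tilde A^{\,1/p^*+1/q}$ for every $n\ge1$. 4. $$\bar\delta_1=\Big(\frac{pp^*}q\Big)^{1/q}=p^{1/q}B,\qquad B<\bar\delta_1<A .$$ -/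

import Mathlib

open MeasureTheory Set
open scoped ENNReal

noncomputable section

/-- Functions on `[0, ∞)` that vanish at `0` and are absolutely continuous on every `[0, b]`.
The values on `(-∞, 0)` play no role, because the measures used below are carried by `(0, ∞)`. -/
def HardyAC0 : Set (ℝ → ℝ) :=
  {f | f 0 = 0 ∧ ∀ b : ℝ, 0 ≤ b → AbsolutelyContinuousOnInterval f 0 b}

/-- The Hardy-type inequality `‖f‖_{L^q(μ)} ≤ C ‖f'‖_{L^p(ν)}` for all absolutely continuous `f`
with `f(0) = 0`. -/
def HardyIneq (p q : ℝ) (μ ν : Measure ℝ) (C : ℝ≥0∞) : Prop :=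
  ∀ f ∈ HardyAC0,
    eLpNorm f (ENNReal.ofReal q) μ ≤ C * eLpNorm (deriv f) (ENNReal.ofReal p) ν

/-- The optimal constant `A`: the supremum of `‖f‖_{L^q(μ)} / ‖f'‖_{L^p(ν)}` over all absolutely
continuous `f` with `f(0) = 0` and `0 < ‖f'‖_{L^p(ν)} < ∞`. -/
def hardyConst (p q : ℝ) (μ ν : Measure ℝ) : ℝ≥0∞ :=
  ⨆ f ∈ {f : ℝ → ℝ | f ∈ HardyAC0 ∧ 0 < eLpNorm (deriv f) (ENNReal.ofReal p) ν ∧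
      eLpNorm (deriv f) (ENNReal.ofReal p) ν < ∞},
    eLpNorm f (ENNReal.ofReal q) μ / eLpNorm (deriv f) (ENNReal.ofReal p) ν

/-- `v̂ = v ^ (1 - p*)`, where `v` is the Lebesgue density of the absolutely continuous part
of `ν`. -/
def hardyHat (p : ℝ) (ν : Measure ℝ) (y : ℝ) : ℝ≥0∞ :=
  ν.rnDeriv volume y ^ (1 - p.conjExponent)

/-- `φ(x) = ν̂(0, x) = ∫₀ˣ v̂`. -/
def hardyPhi (p : ℝ) (ν : Measure ℝ) (x : ℝ) : ℝ≥0∞ :=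
  ∫⁻ y in Ioo 0 x, hardyHat p ν y

/-- `B = sup_{x > 0} ν̂(0, x) ^ (1/p*) μ(x, ∞) ^ (1/q)`. -/
def hardyB (p q : ℝ) (μ ν : Measure ℝ) : ℝ≥0∞ :=
  ⨆ x ∈ Ioi (0 : ℝ), hardyPhi p ν x ^ (1 / p.conjExponent) * μ (Ioi x) ^ (1 / q)

/-- The sharp factor `k_{q,p}` (for `q > p`). -/
def sharpFactor (p q : ℝ) : ℝ :=
  (Real.Gamma (p * q / (q - p)) /
    (Real.Gamma (q / (q - p)) * Real.Gamma (p * (q - 1) / (q - p)))) ^ (1 / p - 1 / q)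

/-- The factor `k̃_{q,p} = (1 + q/p*) ^ (1/q) (1 + p*/q) ^ (1/p*)`. -/
def roughFactor (p q : ℝ) : ℝ :=
  (1 + q / p.conjExponent) ^ (1 / q) * (1 + p.conjExponent / q) ^ (1 / p.conjExponent)

/-- The test functions of the upper approximating procedure, numbered from `1` (the value at index
`0` is not used): `f₁ = ν̂(0, x) ^ γ*` with `γ* = q / (p* + q)`, and
`f_{n+1}(x) = ∫₀ˣ v̂(y) (∫_y^∞ f_n ^ (q/p*) dμ) ^ (p*/q) dy`. -/
def upperSeq (p q : ℝ) (μ ν : Measure ℝ) : ℕ → ℝ → ℝ≥0∞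
  | 0, x => hardyPhi p ν x ^ (q / (p.conjExponent + q))
  | 1, x => hardyPhi p ν x ^ (q / (p.conjExponent + q))
  | n + 2, x => ∫⁻ y in Ioo 0 x, hardyHat p ν y *
      (∫⁻ z in Ioi y, upperSeq p q μ ν (n + 1) z ^ (q / p.conjExponent) ∂μ)
        ^ (p.conjExponent / q)

/-- `(sup_{x > 0} f_{n+1}(x) / f_n(x)) ^ (1/p*)`. -/
def upperRatio (p q : ℝ) (μ ν : Measure ℝ) (n : ℕ) : ℝ≥0∞ :=
  (⨆ x ∈ Ioi (0 : ℝ), upperSeq p q μ ν (n + 1) x / upperSeq p q μ ν n x)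
    ^ (1 / p.conjExponent)

/-- The upper bounds `δ_n`, `n ≥ 1`: the ratio above, except that `δ_n = ∞` if `n ≥ 2` and
`δ_1 = ∞`. -/
def upperDelta (p q : ℝ) (μ ν : Measure ℝ) (n : ℕ) : ℝ≥0∞ :=
  if n = 1 ∨ upperRatio p q μ ν 1 < ∞ then upperRatio p q μ ν n else ∞

/-- `f₁^{(x₀)}(x) = ν̂(0, x ∧ x₀)` for `x ≥ 0` and `x₀ ∈ (0, ∞]`. -/
def lowerTest (p : ℝ) (ν : Measure ℝ) (x₀ : ℝ≥0∞) (x : ℝ) : ℝ :=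
  (hardyPhi p ν (min (ENNReal.ofReal x) x₀).toReal).toReal

/-- The lower bound `δ̄₁ = sup_{x₀ ∈ (0, ∞]} ‖f₁^{(x₀)}‖_{L^q(μ)} / ‖(f₁^{(x₀)})'‖_{L^p(ν)}`.
An indeterminate quotient `∞ / ∞` or `0 / 0` has the value `0` in `ℝ≥0∞`, that is, such an `x₀`
does not contribute. -/
def lowerDelta1 (p q : ℝ) (μ ν : Measure ℝ) : ℝ≥0∞ :=
  ⨆ x₀ ∈ Ioi (0 : ℝ≥0∞),
    eLpNorm (lowerTest p ν x₀) (ENNReal.ofReal q) μ /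
      eLpNorm (deriv (lowerTest p ν x₀)) (ENNReal.ofReal p) ν

/-- Lebesgue measure on `(0, ∞)`. -/
def halfLebesgue : Measure ℝ := volume.restrict (Ioi 0)

/-- The measure `x ^ (-q/p* - 1) dx` on `(0, ∞)`. -/
def blissMeasure (p q : ℝ) : Measure ℝ :=
  halfLebesgue.withDensity fun x => ENNReal.ofReal (x ^ (-q / p.conjExponent - 1))

/-- `α x / (1 + β x^γ) ^ (1/γ)` with `γ = q/p - 1`. -/
def blissFun (p q α β : ℝ) (x : ℝ) : ℝ :=
  α * x / (1 + β * x ^ (q / p - 1)) ^ (1 / (q / p - 1))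

end

/-!
Bliss' inequality is proved by mass transport. Let `f > 0` be a primitive of `h = f'`, and let `T`
be the monotone map carrying the mass `f ^ q x ^ (-m)` onto the mass of the extremal function. The
sum of a multiple of the mass of `f` in `(0, x)`, a function of `T x`, and a coupling term
`f ^ m x ^ (-m/p') T ^ (-γ/p')` vanishes at `0`, and its derivative is at most a multiple of
`h ^ p`: the terms without `h` are absorbed by the weighted AM-GM inequality, the term with `h` by
Young's inequality. Both are equalities when `f` is extremal. This bounds the mass of `f` as long as
it does not exceed the extremal mass; scaling `f` up to that threshold gives the inequality with its
sharp constant, a quotient of Beta integrals.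

The functions `x ^ θ` are eigenfunctions of the iteration `f_n ↦ f_{n+1}`, so `δ_n` does not depend
on `n`. For equal exponents `m = 1 + q/p*` the inequality is Hardy's, which is sharp because
`f = (x / (1 + x)) ^ c` satisfies `x f' ≤ c f` and is admissible for every `c > 1 - 1/m`. The strict
inequalities between the constants are inequalities for quotients of Gamma functions, which follow
from the Beta integral.
-/

section Bliss

open Filter Topology

/-! ### Exponents -/

/-- The exponents of Bliss' inequality: `p'` is conjugate to `p`, the weight is `x ^ (-m)`, and the
extremal functions are multiples of `x / (1 + β x ^ γ) ^ (1 / γ)`, whose mass density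
`f ^ q x ^ (-m)` is a multiple of `x ^ γ (1 + β x ^ γ) ^ (-n)`. -/
structure BlissExponents (p q p' m γ n : ℝ) : Prop where
  one_lt_p : 1 < p
  p_lt_q : p < q
  conj_eq : p' = p / (p - 1)
  m_eq : m = q / p' + 1
  γ_eq : γ = q / p - 1
  n_eq : n = p * q / (q - p)

namespace BlissExponents

theorem of_lt {p q : ℝ} (hp : 1 < p) (hpq : p < q) :
    BlissExponents p q p.conjExponent (q / p.conjExponent + 1) (q / p - 1) (p * q / (q - p)) :=
  ⟨hp, hpq, rfl, rfl, rfl, rfl⟩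

variable {p q p' m γ n : ℝ} (e : BlissExponents p q p' m γ n)
include e

theorem p_pos : 0 < p := zero_lt_one.trans e.one_lt_p

theorem q_pos : 0 < q := e.p_pos.trans e.p_lt_q

theorem p_sub_one_pos : 0 < p - 1 := sub_pos.2 e.one_lt_p

theorem q_sub_p_pos : 0 < q - p := sub_pos.2 e.p_lt_q

theorem holderConjugate : p.HolderConjugate p' :=
  e.conj_eq ▸ Real.HolderConjugate.conjExponent e.one_lt_p

theorem conj_pos : 0 < p' := e.holderConjugate.symm.pos

theorem one_lt_m : 1 < m := by
  have := div_pos e.q_pos e.conj_pos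
  linarith [e.m_eq]

theorem m_pos : 0 < m := zero_lt_one.trans e.one_lt_m

theorem γ_pos : 0 < γ := by
  rw [e.γ_eq, sub_pos, one_lt_div e.p_pos]
  exact e.p_lt_q

theorem one_lt_n : 1 < n := by
  rw [e.n_eq, one_lt_div e.q_sub_p_pos]
  nlinarith [e.one_lt_p, e.p_lt_q]

theorem n_pos : 0 < n := zero_lt_one.trans e.one_lt_n

theorem m_add_γ : m + γ = q := by
  have := e.p_sub_one_pos
  have := e.p_pos
  rw [e.m_eq, e.γ_eq, e.conj_eq]
  field_simp
  ring

theorem n_mul_γ : n * γ = q := by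
  have := e.q_sub_p_pos
  have := e.p_pos
  rw [e.n_eq, e.γ_eq]
  field_simp

theorem γ_add_one_mul_p : (γ + 1) * p = q := by
  have := e.p_pos
  rw [e.γ_eq]
  field_simp
  ring

theorem m_sub_conj : m - m / p' - γ / p' = 1 := by
  have := e.conj_pos
  have := e.m_add_γ
  have := e.m_eq
  field_simp
  field_simp at this
  linarith

end BlissExponents

/-! ### The pointwise inequalities -/

section Pointwise

variable {p q p' m γ n F h x s : ℝ} (e : BlissExponents p q p' m γ n)
include e

/-- The two terms on the right are the second and third contributions to the derivative of
`transportPotential`; the exponents are such that their geometric mean is the left-hand side. -/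
theorem bliss_amgm (hF : 0 < F) (hx : 0 < x) (hs : 0 < s) :
    F ^ q * x ^ (-m) * (1 + s ^ (-γ)) ≤
      m / q * (F ^ m * x ^ (-(m / p') - 1) * s ^ (-(γ / p'))) +
      γ / q * (F ^ m * x ^ (-(m / p')) * s ^ (-(γ / p') - 1) *
        (F ^ q * x ^ (-m) * (s ^ γ * (1 + s ^ γ) ^ (-n))⁻¹)) := by
  have := e.q_pos
  have := e.p_pos
  have := e.conj_pos
  have hweights : m / q + γ / q = 1 := by rw [← add_div, e.m_add_γ, div_self e.q_pos.ne']
  refine le_of_eq_of_le ?_ (Real.geom_mean_le_arith_mean2_weighted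
    (div_nonneg e.m_pos.le e.q_pos.le) (div_nonneg e.γ_pos.le e.q_pos.le)
    (by positivity) (by positivity) hweights)
  have hfactor : 1 + s ^ (-γ) = s ^ (-γ) * (1 + s ^ γ) := by
    rw [mul_add, ← Real.rpow_add hs]
    simp [add_comm]
  rw [hfactor]
  obtain ⟨z, hz⟩ : ∃ z, Real.exp z = 1 + s ^ γ := ⟨_, Real.exp_log (by positivity)⟩
  rw [← hz]
  obtain ⟨u, rfl⟩ : ∃ u, Real.exp u = F := ⟨_, Real.exp_log hF⟩
  obtain ⟨v, rfl⟩ : ∃ v, Real.exp v = x := ⟨_, Real.exp_log hx⟩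
  obtain ⟨w, rfl⟩ : ∃ w, Real.exp w = s := ⟨_, Real.exp_log hs⟩
  simp only [← Real.exp_mul, ← Real.exp_add, ← Real.exp_neg]
  congr 1
  have := e.p_sub_one_pos
  have := e.q_sub_p_pos
  rw [e.m_eq, e.γ_eq, e.n_eq, e.conj_eq]
  field_simp
  ring

theorem bliss_young (hF : 0 < F) (hh : 0 ≤ h) (hx : 0 < x) (hs : 0 < s) :
    h * (F ^ (m - 1) * x ^ (-(m / p')) * s ^ (-(γ / p'))) ≤
      h ^ p / p + F ^ q * x ^ (-m) * s ^ (-γ) / p' := by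
  refine (Real.young_inequality_of_nonneg hh (by positivity) e.holderConjugate).trans_eq ?_
  congr 2
  obtain ⟨u, rfl⟩ : ∃ u, Real.exp u = F := ⟨_, Real.exp_log hF⟩
  obtain ⟨v, rfl⟩ : ∃ v, Real.exp v = x := ⟨_, Real.exp_log hx⟩
  obtain ⟨w, rfl⟩ : ∃ w, Real.exp w = s := ⟨_, Real.exp_log hs⟩
  simp only [← Real.exp_mul, ← Real.exp_add]
  congr 1
  have := e.conj_pos
  rw [e.m_eq]
  field_simp
  ring

end Pointwise

/-! ### Primitives -/

theorem strictMono_primitive {k : ℝ → ℝ} (hk : Continuous k) (hpos : ∀ t, t ≠ 0 → 0 < k t) :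
    StrictMono fun s => ∫ t in (0 : ℝ)..s, k t := by
  have hderiv (s : ℝ) : HasDerivAt (fun s => ∫ t in (0 : ℝ)..s, k t) (k s) s :=
    (hk.integral_hasStrictDerivAt 0 s).hasDerivAt
  have hcont : Continuous fun s => ∫ t in (0 : ℝ)..s, k t :=
    continuous_iff_continuousAt.2 fun s => (hderiv s).continuousAt
  refine StrictMonoOn.Iic_union_Ici (a := 0) ?_ ?_
  · refine strictMonoOn_of_deriv_pos (convex_Iic 0) hcont.continuousOn fun s hs => ?_
    rw [interior_Iic] at hs
    rw [(hderiv s).deriv]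
    exact hpos s (ne_of_lt hs)
  · refine strictMonoOn_of_deriv_pos (convex_Ici 0) hcont.continuousOn fun s hs => ?_
    rw [interior_Ici] at hs
    rw [(hderiv s).deriv]
    exact hpos s (ne_of_gt hs)

theorem isOpenEmbedding_of_strictMono {N : ℝ → ℝ} (hN : StrictMono N) (hcont : Continuous N) :
    IsOpenEmbedding N := by
  refine ⟨hN.isEmbedding_of_ordConnected (isPreconnected_range hcont).ordConnected,
    isOpen_iff_mem_nhds.2 ?_⟩
  rintro _ ⟨s, rfl⟩
  have hleft : N (s - 1) < N s := hN (sub_one_lt s)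
  have hright : N s < N (s + 1) := hN (lt_add_one s)
  filter_upwards [Ioo_mem_nhds hleft hright] with y hy
  exact mem_range_of_exists_le_of_exists_ge hcont ⟨_, hy.1.le⟩ ⟨_, hy.2.le⟩

theorem exists_leftInverse_primitive {k : ℝ → ℝ} (hk : Continuous k)
    (hpos : ∀ t, t ≠ 0 → 0 < k t) :
    ∃ S : ℝ → ℝ, ∀ s, S (∫ t in (0 : ℝ)..s, k t) = s ∧ ContinuousAt S (∫ t in (0 : ℝ)..s, k t) ∧
      (s ≠ 0 → HasDerivAt S (k s)⁻¹ (∫ t in (0 : ℝ)..s, k t)) := by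
  have hderiv (s : ℝ) : HasDerivAt (fun s => ∫ t in (0 : ℝ)..s, k t) (k s) s :=
    (hk.integral_hasStrictDerivAt 0 s).hasDerivAt
  let N := (isOpenEmbedding_of_strictMono (strictMono_primitive hk hpos)
    (continuous_iff_continuousAt.2 fun s => (hderiv s).continuousAt)).toOpenPartialHomeomorph
  have hleft (s : ℝ) : N.symm (N s) = s := N.left_inv (mem_univ s)
  have htarget (s : ℝ) : N s ∈ N.target := N.map_source (mem_univ s)
  refine ⟨N.symm, fun s => ⟨hleft s, N.symm.continuousAt (htarget s), fun hs => ?_⟩⟩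
  refine N.hasDerivAt_symm (htarget s) (hpos s hs).ne' ?_
  exact (hleft s).symm ▸ hderiv s

theorem tendsto_primitive_zero {u : ℝ → ℝ} {X : ℝ} (hX : 0 < X)
    (hu : IntervalIntegrable u volume 0 X) :
    Tendsto (fun x => ∫ t in (0 : ℝ)..x, u t) (𝓝[>] 0) (𝓝 0) := by
  have hcont := intervalIntegral.continuousOn_primitive_interval' hu left_mem_uIcc 0 left_mem_uIcc
  rw [uIcc_of_le hX.le, ContinuousWithinAt, intervalIntegral.integral_same] at hcont
  exact hcont.mono_left
    (nhdsWithin_le_of_mem (mem_of_superset (Ioc_mem_nhdsGT hX) Ioc_subset_Icc_self))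

theorem le_integral_of_hasDerivAt_le_of_tendsto {Ψ d φ : ℝ → ℝ} {X : ℝ} (hX : 0 < X)
    (hderiv : ∀ x ∈ Ioc 0 X, HasDerivAt Ψ (d x) x) (hle : ∀ x ∈ Ioc 0 X, d x ≤ φ x)
    (hφ : IntervalIntegrable φ volume 0 X) (hlim : Tendsto Ψ (𝓝[>] 0) (𝓝 0)) :
    Ψ X ≤ ∫ x in (0 : ℝ)..X, φ x := by
  have hφ' : IntegrableOn φ (Icc 0 X) := (intervalIntegrable_iff_integrableOn_Icc_of_le hX.le).1 hφ
  have hstep : ∀ ε ∈ Ioc 0 X, Ψ X - Ψ ε ≤ ∫ x in ε..X, φ x := fun ε hε => by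
    have hmem : ∀ x ∈ Icc ε X, x ∈ Ioc 0 X := fun x hx => ⟨hε.1.trans_le hx.1, hx.2⟩
    exact intervalIntegral.sub_le_integral_of_hasDeriv_right_of_le hε.2
      (fun x hx => (hderiv x (hmem x hx)).continuousAt.continuousWithinAt)
      (fun x hx => (hderiv x (hmem x (Ioo_subset_Icc_self hx))).hasDerivWithinAt)
      (hφ'.mono_set (Icc_subset_Icc_left hε.1.le))
      (fun x hx => hle x (hmem x (Ioo_subset_Icc_self hx)))
  have hprimitive : Tendsto (fun ε => ∫ x in ε..X, φ x) (𝓝[>] 0) (𝓝 (∫ x in (0 : ℝ)..X, φ x)) := by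
    have hcont := intervalIntegral.continuousOn_primitive_interval_left (f := φ) (μ := volume)
      (by rwa [uIcc_of_le hX.le])
    rw [uIcc_of_le hX.le] at hcont
    exact (hcont 0 (left_mem_Icc.2 hX.le)).mono_left
      (nhdsWithin_le_of_mem (mem_of_superset (Ioc_mem_nhdsGT hX) Ioc_subset_Icc_self))
  rw [← sub_zero (Ψ X)]
  refine le_of_tendsto_of_tendsto (tendsto_const_nhds.sub hlim) hprimitive ?_
  filter_upwards [Ioc_mem_nhdsGT hX] with ε hε using hstep ε hε

theorem exists_linear_bounds {H : ℝ → ℝ} (hH : Continuous H) (hpos : ∀ x, 0 < H x) {X : ℝ}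
    (hX : 0 < X) : ∃ c C, 0 < c ∧ 0 < C ∧ ∀ x ∈ Ioc 0 X,
      c * x ≤ (∫ t in (0 : ℝ)..x, H t) ∧ (∫ t in (0 : ℝ)..x, H t) ≤ C * x := by
  obtain ⟨a, -, hmin⟩ := isCompact_Icc.exists_isMinOn (nonempty_Icc.2 hX.le) hH.continuousOn
  obtain ⟨b, -, hmax⟩ := isCompact_Icc.exists_isMaxOn (nonempty_Icc.2 hX.le) hH.continuousOn
  refine ⟨H a, H b, hpos a, hpos b, fun x hx => ⟨?_, ?_⟩⟩
  · have := intervalIntegral.integral_mono_on hx.1.le (μ := volume) (f := fun _ => H a) (g := H)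
      (by simp) (hH.intervalIntegrable _ _) fun t ht => hmin ⟨ht.1, ht.2.trans hx.2⟩
    simpa [mul_comm] using this
  · have := intervalIntegral.integral_mono_on hx.1.le (μ := volume) (g := fun _ => H b) (f := H)
      (hH.intervalIntegrable _ _) (by simp) fun t ht => hmax ⟨ht.1, ht.2.trans hx.2⟩
    simpa [mul_comm] using this

theorem integral_const_mul_rpow {g : ℝ} (hg : -1 < g) (b x : ℝ) :
    ∫ t in (0 : ℝ)..x, b * t ^ g = b * (x ^ (g + 1) / (g + 1)) := by
  rw [intervalIntegral.integral_const_mul, integral_rpow (Or.inl hg),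
    Real.zero_rpow (by linarith), sub_zero]

theorem intervalIntegrable_of_le_rpow {u : ℝ → ℝ} {b g x : ℝ} (hg : -1 < g) (hx : 0 ≤ x)
    (hu : Measurable u) (hnonneg : ∀ t ∈ Ioc 0 x, 0 ≤ u t)
    (hle : ∀ t ∈ Ioc 0 x, u t ≤ b * t ^ g) : IntervalIntegrable u volume 0 x := by
  refine ((intervalIntegral.intervalIntegrable_rpow' hg).const_mul b).mono_fun
    hu.aestronglyMeasurable ?_
  rw [uIoc_of_le hx]
  filter_upwards [ae_restrict_mem measurableSet_Ioc] with t ht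
  rw [Real.norm_of_nonneg (hnonneg t ht),
    Real.norm_of_nonneg ((hnonneg t ht).trans (hle t ht))]
  exact hle t ht

theorem integral_le_of_le_rpow {u : ℝ → ℝ} {b g x : ℝ} (hg : -1 < g) (hx : 0 ≤ x)
    (hu : IntervalIntegrable u volume 0 x) (hle : ∀ t ∈ Ioc 0 x, u t ≤ b * t ^ g) :
    ∫ t in (0 : ℝ)..x, u t ≤ b * (x ^ (g + 1) / (g + 1)) := by
  rw [← integral_const_mul_rpow hg]
  exact intervalIntegral.integral_mono_on_of_le_Ioo hx hu
    ((intervalIntegral.intervalIntegrable_rpow' hg).const_mul b)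
    fun t ht => hle t (Ioo_subset_Ioc_self ht)

theorem le_integral_of_rpow_le {u : ℝ → ℝ} {b g x : ℝ} (hg : -1 < g) (hx : 0 ≤ x)
    (hu : IntervalIntegrable u volume 0 x) (hle : ∀ t ∈ Ioc 0 x, b * t ^ g ≤ u t) :
    b * (x ^ (g + 1) / (g + 1)) ≤ ∫ t in (0 : ℝ)..x, u t := by
  rw [← integral_const_mul_rpow hg]
  exact intervalIntegral.integral_mono_on_of_le_Ioo hx
    ((intervalIntegral.intervalIntegrable_rpow' hg).const_mul b) hu
    fun t ht => hle t (Ioo_subset_Ioc_self ht)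

/-! ### The extremal mass distribution -/

/-- The mass density `t ^ γ (1 + t ^ γ) ^ (-n)` of the extremal function, extended evenly to `ℝ` so
that it is continuous. -/
noncomputable def blissKernel (γ n t : ℝ) : ℝ := |t| ^ γ * (1 + |t| ^ γ) ^ (-n)

/-- The mass of the extremal distribution in `(0, s)`. -/
noncomputable def blissMass (γ n s : ℝ) : ℝ := ∫ t in (0 : ℝ)..s, blissKernel γ n t

section Kernel

variable {γ n s t : ℝ}

theorem continuous_blissKernel (hγ : 0 < γ) (n : ℝ) : Continuous (blissKernel γ n) := by
  have hpow : Continuous fun t : ℝ => |t| ^ γ := continuous_abs.rpow_const fun _ => Or.inr hγ.le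
  refine hpow.mul ((continuous_const.add hpow).rpow_const fun t => Or.inl ?_)
  exact (add_pos_of_pos_of_nonneg one_pos (by positivity)).ne'

theorem blissKernel_of_pos (ht : 0 < t) : blissKernel γ n t = t ^ γ * (1 + t ^ γ) ^ (-n) := by
  rw [blissKernel, abs_of_pos ht]

theorem blissKernel_pos (ht : t ≠ 0) : 0 < blissKernel γ n t := by
  have : 0 < |t| := abs_pos.2 ht
  rw [blissKernel]
  positivity

theorem hasDerivAt_blissMass (hγ : 0 < γ) (n s : ℝ) :
    HasDerivAt (blissMass γ n) (blissKernel γ n s) s :=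
  ((continuous_blissKernel hγ n).integral_hasStrictDerivAt 0 s).hasDerivAt

theorem continuous_blissMass (hγ : 0 < γ) (n : ℝ) : Continuous (blissMass γ n) :=
  continuous_iff_continuousAt.2 fun s => (hasDerivAt_blissMass hγ n s).continuousAt

theorem blissMass_zero : blissMass γ n 0 = 0 := intervalIntegral.integral_same

theorem blissMass_le (hγ : 0 < γ) (hn : 0 ≤ n) (hs : 0 ≤ s) :
    blissMass γ n s ≤ s ^ (γ + 1) / (γ + 1) := by
  rw [← one_mul (s ^ (γ + 1) / (γ + 1))]
  refine integral_le_of_le_rpow (by linarith) hs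
    ((continuous_blissKernel hγ n).intervalIntegrable _ _) fun t ht => ?_
  rw [blissKernel_of_pos ht.1, mul_comm]
  have : 0 ≤ t ^ γ := Real.rpow_nonneg ht.1.le γ
  gcongr
  exact Real.rpow_le_one_of_one_le_of_nonpos (by linarith) (by linarith)

theorem strictMono_blissMass (hγ : 0 < γ) (n : ℝ) : StrictMono (blissMass γ n) :=
  strictMono_primitive (continuous_blissKernel hγ n) fun _ => blissKernel_pos

end Kernel

/-! ### Transport onto the extremal mass distribution -/

/-- The density `f ^ q x ^ (-m)` of `‖f‖_{L^q}^q` for the weight `x ^ (-m)`. -/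
noncomputable def massDensity (q m : ℝ) (f : ℝ → ℝ) (x : ℝ) : ℝ := f x ^ q * x ^ (-m)

section MassDensity

variable {q m c C X x : ℝ} {f : ℝ → ℝ}

theorem measurable_massDensity (q m : ℝ) (hf : Continuous f) : Measurable (massDensity q m f) :=
  (hf.measurable.pow_const q).mul (measurable_id.pow_const _)

theorem massDensity_pos (hf : 0 < f x) (hx : 0 < x) : 0 < massDensity q m f x :=
  mul_pos (Real.rpow_pos_of_pos hf q) (Real.rpow_pos_of_pos hx (-m))

theorem rpow_mul_rpow_sub_le_massDensity (hq : 0 ≤ q) (hc : 0 ≤ c) (hx : 0 < x) (hf : c * x ≤ f x) :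
    c ^ q * x ^ (q - m) ≤ massDensity q m f x := by
  rw [sub_eq_add_neg, Real.rpow_add hx, ← mul_assoc, ← Real.mul_rpow hc hx.le, massDensity]
  gcongr

theorem massDensity_le_rpow_mul_rpow_sub (hq : 0 ≤ q) (hC : 0 ≤ C) (hx : 0 < x) (hf0 : 0 ≤ f x)
    (hf : f x ≤ C * x) : massDensity q m f x ≤ C ^ q * x ^ (q - m) := by
  rw [sub_eq_add_neg, Real.rpow_add hx, ← mul_assoc, ← Real.mul_rpow hC hx.le, massDensity]
  gcongr

theorem intervalIntegrable_massDensity (hq : 0 ≤ q) (hqm : -1 < q - m) (hC : 0 ≤ C) (hX : 0 ≤ X)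
    (hf : Continuous f) (hf0 : ∀ x ∈ Ioc 0 X, 0 ≤ f x) (hfC : ∀ x ∈ Ioc 0 X, f x ≤ C * x) :
    IntervalIntegrable (massDensity q m f) volume 0 X :=
  intervalIntegrable_of_le_rpow hqm hX (measurable_massDensity q m hf)
    (fun x hx => mul_nonneg (Real.rpow_nonneg (hf0 x hx) q) (Real.rpow_nonneg hx.1.le (-m)))
    fun x hx => massDensity_le_rpow_mul_rpow_sub hq hC hx.1 (hf0 x hx) (hfC x hx)

end MassDensity

/-- `T` transports the mass distribution `massDensity q m f` on `(0, X]` onto an initial segment of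
the extremal distribution `blissKernel γ n`. -/
structure IsBlissTransport (q m γ n X : ℝ) (f T : ℝ → ℝ) : Prop where
  pos : ∀ x ∈ Ioc 0 X, 0 < T x
  tendsto_zero : Tendsto T (𝓝[>] 0) (𝓝 0)
  mass_eq : ∀ x ∈ Ioc 0 X, blissMass γ n (T x) = ∫ t in (0 : ℝ)..x, massDensity q m f t
  hasDerivAt : ∀ x ∈ Ioc 0 X,
    HasDerivAt T (massDensity q m f x * (blissKernel γ n (T x))⁻¹) x

section Existence

variable {q m γ n X Y x y : ℝ} {f : ℝ → ℝ}

theorem hasDerivAt_integral_massDensity (hq : 0 ≤ q) (hf : Continuous f) (hx : 0 < x)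
    (hint : IntervalIntegrable (massDensity q m f) volume 0 x) :
    HasDerivAt (fun x => ∫ t in (0 : ℝ)..x, massDensity q m f t) (massDensity q m f x) x :=
  intervalIntegral.integral_hasDerivAt_right hint
    (measurable_massDensity q m hf).stronglyMeasurable.stronglyMeasurableAtFilter
    ((hf.continuousAt.rpow_const (Or.inr hq)).mul
      (continuousAt_id.rpow_const (Or.inl hx.ne')))

theorem integral_massDensity_mem_Ioc (hf0 : ∀ x ∈ Ioc 0 X, 0 < f x)
    (hint : IntervalIntegrable (massDensity q m f) volume 0 X) (hx : x ∈ Ioc 0 X) :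
    ∫ t in (0 : ℝ)..x, massDensity q m f t ∈ Ioc 0 (∫ t in (0 : ℝ)..X, massDensity q m f t) := by
  have hpos : ∀ t ∈ Ioc 0 X, 0 < massDensity q m f t := fun t ht =>
    massDensity_pos (hf0 t ht) ht.1
  have hint' := hint.mono_set (uIcc_subset_uIcc left_mem_uIcc
    (uIcc_of_le (hx.1.le.trans hx.2) ▸ Ioc_subset_Icc_self hx))
  refine ⟨intervalIntegral.intervalIntegral_pos_of_pos_on hint'
    (fun t ht => hpos t ⟨ht.1, ht.2.le.trans hx.2⟩) hx.1,
    intervalIntegral.integral_mono_interval le_rfl hx.1.le hx.2 ?_ hint⟩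
  filter_upwards [ae_restrict_mem measurableSet_Ioc] with t ht using (hpos t ht).le

theorem exists_blissMass_eq (hγ : 0 < γ) (hy : 0 < y) (hyY : y ≤ blissMass γ n Y) :
    ∃ s, 0 < s ∧ blissMass γ n s = y := by
  obtain ⟨s, hs⟩ := mem_range_of_exists_le_of_exists_ge (continuous_blissMass hγ n)
    ⟨0, blissMass_zero.trans_le hy.le⟩ ⟨Y, hyY⟩
  refine ⟨s, (strictMono_blissMass hγ n).lt_iff_lt.1 ?_, hs⟩
  rwa [hs, blissMass_zero]

theorem exists_isBlissTransport (hγ : 0 < γ) (hq : 0 ≤ q) (hX : 0 < X) (hf : Continuous f)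
    (hf0 : ∀ x ∈ Ioc 0 X, 0 < f x)
    (hint : IntervalIntegrable (massDensity q m f) volume 0 X)
    (hle : ∫ t in (0 : ℝ)..X, massDensity q m f t ≤ blissMass γ n Y) :
    ∃ T, IsBlissTransport q m γ n X f T := by
  set M : ℝ → ℝ := fun x => ∫ t in (0 : ℝ)..x, massDensity q m f t with hM
  obtain ⟨S, hS⟩ : ∃ S : ℝ → ℝ, ∀ s, S (blissMass γ n s) = s ∧ ContinuousAt S (blissMass γ n s) ∧
      (s ≠ 0 → HasDerivAt S (blissKernel γ n s)⁻¹ (blissMass γ n s)) :=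
    exists_leftInverse_primitive (continuous_blissKernel hγ n) fun _ => blissKernel_pos
  have hSM : ∀ x ∈ Ioc 0 X, 0 < S (M x) ∧ blissMass γ n (S (M x)) = M x := fun x hx => by
    obtain ⟨hpos, hMX⟩ := integral_massDensity_mem_Ioc hf0 hint hx
    obtain ⟨s, hs, hsM⟩ := exists_blissMass_eq hγ hpos (hMX.trans hle)
    simp only [hM, ← hsM, (hS s).1, hs, and_self]
  refine ⟨fun x => S (M x), fun x hx => (hSM x hx).1, ?_, fun x hx => (hSM x hx).2,
    fun x hx => ?_⟩
  · have hS0 := (hS 0).2.1.tendsto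
    rw [(hS 0).1, blissMass_zero] at hS0
    exact hS0.comp (tendsto_primitive_zero hX hint)
  · have hSderiv := (hS (S (M x))).2.2 (hSM x hx).1.ne'
    rw [(hSM x hx).2] at hSderiv
    rw [mul_comm]
    exact hSderiv.comp x (hasDerivAt_integral_massDensity hq hf hx.1 (hint.mono_set
      (uIcc_subset_uIcc left_mem_uIcc (uIcc_of_le hX.le ▸ Ioc_subset_Icc_self hx))))

end Existence

/-! ### The potential of the transport -/

/-- The potential whose derivative along a transport `T` is dominated by a multiple of `f' ^ p`; its
first term is a multiple of the mass of `f` in `(0, x)`. -/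
noncomputable def transportPotential (p q p' m γ n : ℝ) (f T : ℝ → ℝ) (x : ℝ) : ℝ :=
  m / p * blissMass γ n (T x) + 1 / n * (T x * (1 + T x ^ γ) ^ (1 - n)) +
    p' / q * (f x ^ m * x ^ (-(m / p')) * T x ^ (-(γ / p')))

section Potential

variable {p q p' m γ n X x s h c C : ℝ} {f T : ℝ → ℝ}

theorem hasDerivAt_blissMass_add_rpow (e : BlissExponents p q p' m γ n) (hs : 0 < s) :
    HasDerivAt (fun s => m / p * blissMass γ n s + 1 / n * (s * (1 + s ^ γ) ^ (1 - n)))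
      (blissKernel γ n s * (1 + γ / q * s ^ (-γ))) s := by
  have hone : 0 < 1 + s ^ γ := by positivity
  have hmass := (hasDerivAt_blissMass e.γ_pos n s).const_mul (m / p)
  have hpow := ((hasDerivAt_id s).mul ((((hasDerivAt_id s).rpow_const (p := γ)
    (Or.inl hs.ne')).const_add 1).rpow_const (p := 1 - n) (Or.inl hone.ne'))).const_mul (1 / n)
  refine (hmass.add hpow).congr_deriv ?_
  have hsub : (1 + s ^ γ) ^ (1 - n) = (1 + s ^ γ) * (1 + s ^ γ) ^ (-n) := by
    rw [sub_eq_add_neg, Real.rpow_add hone, Real.rpow_one]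
  have hneg : (1 + s ^ γ) ^ (1 - n - 1) = (1 + s ^ γ) ^ (-n) := by ring_nf
  simp only [id, one_mul]
  rw [blissKernel_of_pos hs, Real.rpow_sub_one hs.ne', hsub, hneg, Real.rpow_neg hs.le γ]
  have hn : 1 / n = γ / q := by rw [← e.n_mul_γ, div_mul_cancel_right₀ e.γ_pos.ne', one_div]
  have hcoeff : m / p + γ / q * (1 - m) = 1 := by
    have := e.p_pos
    have := e.p_sub_one_pos
    have := e.q_pos
    rw [e.m_eq, e.γ_eq, e.conj_eq]
    field_simp
    ring
  have : 0 < s ^ γ := by positivity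
  rw [hn]
  field_simp
  linear_combination s ^ γ * hcoeff - γ / q * s ^ γ * e.n_mul_γ + γ / q * s ^ γ * e.m_add_γ

theorem hasDerivAt_transportPotential (e : BlissExponents p q p' m γ n) (hx : 0 < x)
    (hf0 : 0 < f x) (hT0 : 0 < T x) (hf : HasDerivAt f h x)
    (hT : HasDerivAt T (massDensity q m f x * (blissKernel γ n (T x))⁻¹) x) :
    HasDerivAt (transportPotential p q p' m γ n f T)
      (massDensity q m f x * (1 + γ / q * T x ^ (-γ)) +
        (p' * m / q * (h * (f x ^ (m - 1) * x ^ (-(m / p')) * T x ^ (-(γ / p')))) -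
        (m / q * (f x ^ m * x ^ (-(m / p') - 1) * T x ^ (-(γ / p'))) +
          γ / q * (f x ^ m * x ^ (-(m / p')) * T x ^ (-(γ / p') - 1) *
            (massDensity q m f x * (blissKernel γ n (T x))⁻¹))))) x := by
  have hmass := (hasDerivAt_blissMass_add_rpow e hT0).comp x hT
  have hcoupling := (((hf.rpow_const (p := m) (Or.inl hf0.ne')).mul
    ((hasDerivAt_id x).rpow_const (p := -(m / p')) (Or.inl hx.ne'))).mul
    (hT.rpow_const (p := -(γ / p')) (Or.inl hT0.ne'))).const_mul (p' / q)
  refine (hmass.add hcoupling).congr_deriv ?_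
  have := e.q_pos
  have := e.conj_pos
  have := (blissKernel_pos (γ := γ) (n := n) hT0.ne').ne'
  simp only [id, Pi.mul_apply, one_mul]
  field_simp
  ring

theorem deriv_transportPotential_le (e : BlissExponents p q p' m γ n) (hx : 0 < x)
    (hf0 : 0 < f x) (hT0 : 0 < T x) (hh : 0 ≤ h) :
    massDensity q m f x * (1 + γ / q * T x ^ (-γ)) +
        (p' * m / q * (h * (f x ^ (m - 1) * x ^ (-(m / p')) * T x ^ (-(γ / p')))) -
        (m / q * (f x ^ m * x ^ (-(m / p') - 1) * T x ^ (-(γ / p'))) +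
          γ / q * (f x ^ m * x ^ (-(m / p')) * T x ^ (-(γ / p') - 1) *
            (massDensity q m f x * (blissKernel γ n (T x))⁻¹)))) ≤
      p' * m / (q * p) * h ^ p := by
  have := e.q_pos
  have := e.p_pos
  have := e.conj_pos
  have := e.m_pos
  have hamgm := bliss_amgm e hf0 hx hT0
  have hyoung := mul_le_mul_of_nonneg_left (bliss_young e hf0 hh hx hT0)
    (show 0 ≤ p' * m / q by positivity)
  have hdensity : f x ^ q * x ^ (-m) = massDensity q m f x := rfl
  rw [hdensity, ← blissKernel_of_pos hT0] at hamgm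
  rw [hdensity] at hyoung
  have hexpand : p' * m / q * (h ^ p / p + massDensity q m f x * T x ^ (-γ) / p') =
      p' * m / (q * p) * h ^ p + m / q * (massDensity q m f x * T x ^ (-γ)) := by
    field_simp
  have hsplit : massDensity q m f x * (1 + γ / q * T x ^ (-γ)) =
      massDensity q m f x * (1 + T x ^ (-γ)) - m / q * (massDensity q m f x * T x ^ (-γ)) := by
    rw [← e.m_add_γ]
    have : 0 < m + γ := e.m_add_γ ▸ e.q_pos
    field_simp
    ring
  linarith

theorem IsBlissTransport.mul_le (e : BlissExponents p q p' m γ n)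
    (hT : IsBlissTransport q m γ n X f T) (hc : 0 ≤ c) (hf : ∀ x ∈ Ioc 0 X, c * x ≤ f x)
    (hint : IntervalIntegrable (massDensity q m f) volume 0 X) (hx : x ∈ Ioc 0 X) :
    c ^ p * x ≤ T x := by
  have hγ := e.γ_pos
  have hqm : q - m = γ := by linarith [e.m_add_γ]
  have hTx := hT.pos x hx
  have hlower : c ^ q * (x ^ (γ + 1) / (γ + 1)) ≤ blissMass γ n (T x) := by
    rw [hT.mass_eq x hx, ← hqm]
    refine le_integral_of_rpow_le (by linarith) hx.1.le (hint.mono_set (uIcc_subset_uIcc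
      left_mem_uIcc (uIcc_of_le (hx.1.le.trans hx.2) ▸ Ioc_subset_Icc_self hx))) fun t ht => ?_
    exact rpow_mul_rpow_sub_le_massDensity e.q_pos.le hc ht.1 (hf t ⟨ht.1, ht.2.trans hx.2⟩)
  have hpow : (c ^ p * x) ^ (γ + 1) ≤ T x ^ (γ + 1) := by
    have hupper := hlower.trans (blissMass_le hγ e.n_pos.le hTx.le)
    rw [← mul_div_assoc, div_le_div_iff_of_pos_right (by linarith)] at hupper
    rwa [Real.mul_rpow (by positivity) hx.1.le, ← Real.rpow_mul hc, mul_comm p,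
      e.γ_add_one_mul_p]
  have := hx.1
  exact (Real.rpow_le_rpow_iff (by positivity) hTx.le (by linarith)).1 hpow

theorem tendsto_coupling_zero (e : BlissExponents p q p' m γ n) (hX : 0 < X) (hc : 0 < c)
    (hC : 0 ≤ C) (hf0 : ∀ x ∈ Ioc 0 X, 0 ≤ f x) (hf : ∀ x ∈ Ioc 0 X, f x ≤ C * x)
    (hT : ∀ x ∈ Ioc 0 X, c * x ≤ T x) :
    Tendsto (fun x => f x ^ m * x ^ (-(m / p')) * T x ^ (-(γ / p'))) (𝓝[>] 0) (𝓝 0) := by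
  have hbound : ∀ x ∈ Ioc 0 X,
      f x ^ m * x ^ (-(m / p')) * T x ^ (-(γ / p')) ≤ C ^ m * c ^ (-(γ / p')) * x := fun x hx => by
    have hx0 := hx.1
    calc f x ^ m * x ^ (-(m / p')) * T x ^ (-(γ / p'))
        ≤ (C * x) ^ m * x ^ (-(m / p')) * (c * x) ^ (-(γ / p')) := by
          have : 0 ≤ T x := (mul_pos hc hx0).le.trans (hT x hx)
          gcongr ?_ * _ * ?_
          · exact Real.rpow_le_rpow (hf0 x hx) (hf x hx) e.m_pos.le
          · exact Real.rpow_le_rpow_of_nonpos (by positivity) (hT x hx)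
              (neg_nonpos.2 (div_nonneg e.γ_pos.le e.conj_pos.le))
      _ = C ^ m * c ^ (-(γ / p')) * (x ^ m * x ^ (-(m / p')) * x ^ (-(γ / p'))) := by
          rw [Real.mul_rpow hC hx0.le, Real.mul_rpow hc.le hx0.le]
          ring
      _ = C ^ m * c ^ (-(γ / p')) * x := by
          rw [← Real.rpow_add hx0, ← Real.rpow_add hx0, ← sub_eq_add_neg, ← sub_eq_add_neg,
            e.m_sub_conj, Real.rpow_one]
  have hlin : Tendsto (fun x => C ^ m * c ^ (-(γ / p')) * x) (𝓝[>] 0) (𝓝 0) := by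
    have := (continuous_const_mul (C ^ m * c ^ (-(γ / p')))).tendsto 0
    rw [mul_zero] at this
    exact this.mono_left nhdsWithin_le_nhds
  refine squeeze_zero' ?_ ?_ hlin
  · filter_upwards [Ioc_mem_nhdsGT hX] with x hx
    have := hf0 x hx
    have := hx.1
    have : 0 ≤ T x := (mul_pos hc hx.1).le.trans (hT x hx)
    positivity
  · filter_upwards [Ioc_mem_nhdsGT hX] with x hx using hbound x hx

theorem IsBlissTransport.tendsto_transportPotential (e : BlissExponents p q p' m γ n) (hX : 0 < X)
    (hT : IsBlissTransport q m γ n X f T) (hc : 0 < c) (hC : 0 ≤ C)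
    (hf : ∀ x ∈ Ioc 0 X, c * x ≤ f x ∧ f x ≤ C * x)
    (hint : IntervalIntegrable (massDensity q m f) volume 0 X) :
    Tendsto (transportPotential p q p' m γ n f T) (𝓝[>] 0) (𝓝 0) := by
  have hf0 : ∀ x ∈ Ioc 0 X, 0 ≤ f x := fun x hx => (mul_pos hc hx.1).le.trans (hf x hx).1
  have hmass : Tendsto (fun x => blissMass γ n (T x)) (𝓝[>] 0) (𝓝 0) :=
    (((continuous_blissMass e.γ_pos n).tendsto' 0 0 blissMass_zero).comp hT.tendsto_zero)
  have hprofile : Tendsto (fun x => T x * (1 + T x ^ γ) ^ (1 - n)) (𝓝[>] 0) (𝓝 0) := by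
    have hcont : ContinuousAt (fun s : ℝ => s * (1 + s ^ γ) ^ (1 - n)) 0 := by
      refine continuousAt_id.mul ((continuousAt_const.add
        (Real.continuousAt_rpow_const 0 γ (Or.inr e.γ_pos.le))).rpow_const (Or.inl ?_))
      simp [e.γ_pos.ne']
    have hzero := hcont.tendsto
    rw [zero_mul] at hzero
    exact hzero.comp hT.tendsto_zero
  have hcoupling := tendsto_coupling_zero e hX (Real.rpow_pos_of_pos hc p) hC hf0
    (fun x hx => (hf x hx).2) fun x hx => hT.mul_le e hc.le (fun x hx => (hf x hx).1) hint hx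
  have hsum := ((hmass.const_mul (m / p)).add (hprofile.const_mul (1 / n))).add
    (hcoupling.const_mul (p' / q))
  rwa [mul_zero, mul_zero, mul_zero, add_zero, add_zero] at hsum

end Potential

/-! ### Bliss' inequality on bounded intervals -/

section Interval

variable {p q p' m γ n X Y : ℝ} {H : ℝ → ℝ}

theorem bliss_of_mass_le (e : BlissExponents p q p' m γ n) (hH : Continuous H)
    (hpos : ∀ x, 0 < H x) (hX : 0 < X)
    (hle : ∫ x in (0 : ℝ)..X, massDensity q m (fun x => ∫ t in (0 : ℝ)..x, H t) x ≤
      blissMass γ n Y) :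
    ∫ x in (0 : ℝ)..X, massDensity q m (fun x => ∫ t in (0 : ℝ)..x, H t) x ≤
      p' / q * ∫ x in (0 : ℝ)..X, H x ^ p := by
  set f : ℝ → ℝ := fun x => ∫ t in (0 : ℝ)..x, H t
  have hfderiv (x : ℝ) : HasDerivAt f (H x) x := (hH.integral_hasStrictDerivAt 0 x).hasDerivAt
  have hfcont : Continuous f := continuous_iff_continuousAt.2 fun x => (hfderiv x).continuousAt
  obtain ⟨c, C, hc, hC, hf⟩ := exists_linear_bounds hH hpos hX
  have hf0 : ∀ x ∈ Ioc 0 X, 0 < f x := fun x hx => (mul_pos hc hx.1).trans_le (hf x hx).1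
  have hqm : -1 < q - m := by linarith [e.m_add_γ, e.γ_pos]
  have hint := intervalIntegrable_massDensity e.q_pos.le hqm hC.le hX.le hfcont
    (fun x hx => (hf0 x hx).le) fun x hx => (hf x hx).2
  obtain ⟨T, hT⟩ := exists_isBlissTransport e.γ_pos e.q_pos.le hX hfcont hf0 hint hle
  have hHp : Continuous fun x => p' * m / (q * p) * H x ^ p :=
    (hH.rpow_const fun x => Or.inr e.p_pos.le).const_mul _
  have hpotential : transportPotential p q p' m γ n f T X ≤
      p' * m / (q * p) * ∫ x in (0 : ℝ)..X, H x ^ p := by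
    rw [← intervalIntegral.integral_const_mul]
    exact le_integral_of_hasDerivAt_le_of_tendsto hX
      (fun x hx => hasDerivAt_transportPotential e hx.1 (hf0 x hx) (hT.pos x hx) (hfderiv x)
        (hT.hasDerivAt x hx))
      (fun x hx => deriv_transportPotential_le e hx.1 (hf0 x hx) (hT.pos x hx) (hpos x).le)
      (hHp.intervalIntegrable _ _) (hT.tendsto_transportPotential e hX hc hC.le hf hint)
  have hXmem : X ∈ Ioc 0 X := right_mem_Ioc.2 hX
  have := e.p_pos
  have := e.q_pos
  have := e.m_pos
  have := e.n_pos
  have := e.conj_pos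
  have hmass : m / p * (∫ x in (0 : ℝ)..X, massDensity q m f x) ≤
      transportPotential p q p' m γ n f T X := by
    have := hf0 X hXmem
    have := hT.pos X hXmem
    rw [← hT.mass_eq X hXmem, transportPotential, add_assoc]
    exact le_add_of_nonneg_right (by positivity)
  have hscaled := hmass.trans hpotential
  rw [show p' * m / (q * p) = m / p * (p' / q) by ring, mul_assoc] at hscaled
  exact le_of_mul_le_mul_left hscaled (by positivity)

end Interval

section Scaling

variable {p q p' m γ n J K M X : ℝ} {H : ℝ → ℝ}

theorem le_rpow_mul_rpow_of_scaling (hp : 0 < p) (hq : 0 < q) (hJ : 0 < J) (hK : 0 ≤ K)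
    (h : ∀ l, 0 < l → l ^ q * M < J → l ^ q * M ≤ l ^ p * K) :
    M ≤ J ^ (1 - q / p) * K ^ (q / p) := by
  rcases le_or_gt M 0 with hM | hM
  · exact hM.trans (by positivity)
  set l₀ : ℝ := (J / M) ^ (1 / q) with hl₀
  have hl₀pos : 0 < l₀ := by positivity
  have hl₀q : l₀ ^ q = J / M := by
    rw [hl₀, ← Real.rpow_mul (by positivity), one_div_mul_cancel hq.ne', Real.rpow_one]
  have hmem : ∀ᶠ l in 𝓝[<] l₀, l ^ q * M ≤ l ^ p * K := by
    filter_upwards [Ioo_mem_nhdsLT hl₀pos] with l hl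
    refine h l hl.1 ((lt_div_iff₀ hM).1 ?_)
    exact hl₀q ▸ Real.rpow_lt_rpow hl.1.le hl.2 hq
  have hcont (a : ℝ) : Tendsto (fun l : ℝ => l ^ a) (𝓝[<] l₀) (𝓝 (l₀ ^ a)) :=
    (Real.continuousAt_rpow_const l₀ a (Or.inl hl₀pos.ne')).tendsto.mono_left nhdsWithin_le_nhds
  have hlimit : J ≤ l₀ ^ p * K := by
    have := le_of_tendsto_of_tendsto ((hcont q).mul_const M) ((hcont p).mul_const K) hmem
    rwa [hl₀q, div_mul_cancel₀ _ hM.ne'] at this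
  have hraise := Real.rpow_le_rpow hJ.le hlimit (div_nonneg hq.le hp.le)
  rw [Real.mul_rpow (by positivity) hK, ← Real.rpow_mul hl₀pos.le, mul_div_cancel₀ _ hp.ne',
    hl₀q, div_mul_eq_mul_div, le_div_iff₀ hM] at hraise
  rw [Real.rpow_sub hJ, Real.rpow_one, div_mul_eq_mul_div, le_div_iff₀ (by positivity), mul_comm]
  exact hraise

theorem integral_massDensity_const_mul {l : ℝ} (hl : 0 ≤ l) (hH : ∀ x, 0 ≤ H x) (hX : 0 ≤ X) :
    ∫ x in (0 : ℝ)..X, massDensity q m (fun x => ∫ t in (0 : ℝ)..x, l * H t) x =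
      l ^ q * ∫ x in (0 : ℝ)..X, massDensity q m (fun x => ∫ t in (0 : ℝ)..x, H t) x := by
  rw [← intervalIntegral.integral_const_mul]
  refine intervalIntegral.integral_congr fun x hx => ?_
  rw [uIcc_of_le hX] at hx
  simp only [massDensity, intervalIntegral.integral_const_mul]
  rw [Real.mul_rpow hl (intervalIntegral.integral_nonneg hx.1 fun t _ => hH t), mul_assoc]

theorem integral_rpow_const_mul {l : ℝ} (hl : 0 ≤ l) (hH : ∀ x, 0 ≤ H x) :
    ∫ x in (0 : ℝ)..X, (l * H x) ^ p = l ^ p * ∫ x in (0 : ℝ)..X, H x ^ p := by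
  simp only [Real.mul_rpow hl (hH _), intervalIntegral.integral_const_mul]

theorem bliss_interval (e : BlissExponents p q p' m γ n)
    (hint : IntegrableOn (blissKernel γ n) (Ioi 0)) (hJ : 0 < ∫ t in Ioi 0, blissKernel γ n t)
    (hH : Continuous H) (hpos : ∀ x, 0 < H x) (hX : 0 < X) :
    ∫ x in (0 : ℝ)..X, massDensity q m (fun x => ∫ t in (0 : ℝ)..x, H t) x ≤
      (∫ t in Ioi 0, blissKernel γ n t) ^ (1 - q / p) *
        (p' / q * ∫ x in (0 : ℝ)..X, H x ^ p) ^ (q / p) := by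
  have henergy : 0 ≤ ∫ x in (0 : ℝ)..X, H x ^ p :=
    intervalIntegral.integral_nonneg hX.le fun x _ => Real.rpow_nonneg (hpos x).le p
  refine le_rpow_mul_rpow_of_scaling e.p_pos e.q_pos hJ
    (mul_nonneg (div_nonneg e.conj_pos.le e.q_pos.le) henergy) fun l hl hlt => ?_
  obtain ⟨Y, hY⟩ : ∃ Y, l ^ q * (∫ x in (0 : ℝ)..X,
      massDensity q m (fun x => ∫ t in (0 : ℝ)..x, H t) x) < blissMass γ n Y :=
    ((intervalIntegral_tendsto_integral_Ioi 0 hint tendsto_id).eventually (lt_mem_nhds hlt)).exists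
  rw [← integral_massDensity_const_mul hl.le (fun x => (hpos x).le) hX.le] at hY ⊢
  refine (bliss_of_mass_le e (H := fun t => l * H t) (by fun_prop) (fun x => mul_pos hl (hpos x)) hX
    hY.le).trans_eq ?_
  rw [integral_rpow_const_mul hl.le fun x => (hpos x).le]
  ring

end Scaling

/-! ### Reduction to positive continuous derivatives -/

section Reduction

variable {r : ℝ≥0∞} {h : ℝ → ℝ}

theorem exists_continuous_pos_eLpNorm_sub_le {μ : Measure ℝ} [IsLocallyFiniteMeasure μ]
    {w : ℝ → ℝ} {ε : ℝ≥0∞} (hr : 1 ≤ r) (hr' : r ≠ ∞) (hw : Continuous w) (hw0 : ∀ x, 0 < w x)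
    (hwm : MemLp w r μ) (hh : MemLp h r μ) (hε : ε ≠ 0) :
    ∃ H : ℝ → ℝ, Continuous H ∧ (∀ x, 0 < H x) ∧ MemLp H r μ ∧
      eLpNorm (H - fun x => |h x|) r μ ≤ ε := by
  have hε' : ε / 2 ≠ 0 := ENNReal.div_ne_zero.2 ⟨hε, by simp⟩
  obtain ⟨k, hk, hkm⟩ := hh.exists_boundedContinuous_eLpNorm_sub_le hr' hε'
  obtain ⟨c, hc, hcε⟩ := ENNReal.exists_nnreal_pos_mul_lt hwm.2.ne hε'
  have hcw : MemLp ((c : ℝ) • w) r μ := hwm.const_smul _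
  have habs : eLpNorm (fun x => |k x| - |h x|) r μ ≤ ε / 2 := by
    refine (eLpNorm_mono fun x => ?_).trans hk
    rw [Pi.sub_apply, norm_sub_rev (h x)]
    exact abs_abs_sub_abs_le (k x) (h x)
  have hsmul : eLpNorm ((c : ℝ) • w) r μ ≤ ε / 2 := by
    rw [eLpNorm_const_smul, Real.enorm_of_nonneg c.coe_nonneg, ENNReal.ofReal_coe_nnreal]
    exact hcε.le
  refine ⟨(fun x => |k x|) + (c : ℝ) • w, k.continuous.abs.add (hw.const_smul _),
    fun x => add_pos_of_nonneg_of_pos (abs_nonneg _) (mul_pos hc (hw0 x)), hkm.norm.add hcw, ?_⟩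
  calc eLpNorm ((fun x => |k x|) + (c : ℝ) • w - fun x => |h x|) r μ
      = eLpNorm ((fun x => |k x| - |h x|) + (c : ℝ) • w) r μ := by
        congr 1
        ext x
        simp only [Pi.add_apply, Pi.sub_apply]
        ring
    _ ≤ ε / 2 + ε / 2 :=
        (eLpNorm_add_le (hkm.1.norm.sub hh.1.norm) hcw.1 hr).trans (add_le_add habs hsmul)
    _ = ε := ENNReal.add_halves ε

theorem memLp_exp_neg_halfLebesgue (hr : r ≠ 0) (hr' : r ≠ ∞) :
    MemLp (fun x : ℝ => Real.exp (-x)) r halfLebesgue := by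
  rw [← integrable_norm_rpow_iff (by fun_prop) hr hr']
  refine (integrableOn_exp_mul_Ioi (neg_lt_zero.2 (ENNReal.toReal_pos hr hr')) 0).congr_fun
    (fun x _ => ?_) measurableSet_Ioi
  simp only [Real.norm_eq_abs, Real.abs_exp, ← Real.exp_mul]
  ring_nf

theorem exists_seq_continuous_pos_tendsto (hr : 1 ≤ r) (hr' : r ≠ ∞) (hh : MemLp h r halfLebesgue) :
    ∃ H : ℕ → ℝ → ℝ, (∀ n, Continuous (H n)) ∧ (∀ n x, 0 < H n x) ∧
      (∀ n, MemLp (H n) r halfLebesgue) ∧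
      Tendsto (fun n => eLpNorm (H n - fun x => |h x|) r halfLebesgue) atTop (𝓝 0) := by
  have : IsLocallyFiniteMeasure halfLebesgue := by unfold halfLebesgue; infer_instance
  choose H hcont hpos hmem hle using fun n : ℕ => exists_continuous_pos_eLpNorm_sub_le hr hr'
    (by fun_prop) (fun x => Real.exp_pos (-x))
    (memLp_exp_neg_halfLebesgue (one_pos.trans_le hr).ne' hr') hh
    (ENNReal.inv_ne_zero.2 (ENNReal.natCast_ne_top n))
  exact ⟨H, hcont, hpos, hmem, tendsto_of_tendsto_of_tendsto_of_le_of_le tendsto_const_nhds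
    ENNReal.tendsto_inv_nat_nhds_zero (fun _ => zero_le) hle⟩

theorem tendsto_intervalIntegral_of_tendsto_eLpNorm {H : ℕ → ℝ → ℝ} {x : ℝ} (hr : 1 ≤ r)
    (hx : 0 ≤ x) (hH : ∀ n, MemLp (H n) r halfLebesgue) (hh : MemLp h r halfLebesgue)
    (hlim : Tendsto (fun n => eLpNorm (H n - h) r halfLebesgue) atTop (𝓝 0)) :
    Tendsto (fun n => ∫ t in (0 : ℝ)..x, H n t) atTop (𝓝 (∫ t in (0 : ℝ)..x, h t)) := by
  set μ : Measure ℝ := volume.restrict (Ioc 0 x)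
  have hμ : μ ≤ halfLebesgue := Measure.restrict_mono (fun t ht => ht.1) le_rfl
  have hintegrable {g : ℝ → ℝ} (hg : MemLp g r halfLebesgue) : Integrable g μ :=
    (hg.mono_measure hμ).integrable hr
  set K : ℝ≥0∞ := μ univ ^ (1 / (1 : ℝ≥0∞).toReal - 1 / r.toReal)
  have hK : K ≠ ∞ := by
    refine ENNReal.rpow_ne_top_of_nonneg ?_ (measure_ne_top μ univ)
    rw [ENNReal.toReal_one, div_one, sub_nonneg, one_div, ← ENNReal.toReal_inv]
    exact ENNReal.toReal_le_of_le_ofReal one_pos.le (by simpa using hr)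
  have hholder (n : ℕ) : eLpNorm (H n - h) 1 μ ≤ eLpNorm (H n - h) r halfLebesgue * K :=
    (eLpNorm_le_eLpNorm_mul_rpow_measure_univ hr (((hH n).sub hh).mono_measure hμ).1).trans
      (mul_le_mul_left (eLpNorm_mono_measure _ hμ) K)
  have hlim₁ : Tendsto (fun n => eLpNorm (H n - h) 1 μ) atTop (𝓝 0) := by
    refine tendsto_of_tendsto_of_tendsto_of_le_of_le tendsto_const_nhds ?_ (fun _ => zero_le)
      hholder
    simpa only [zero_mul] using ENNReal.Tendsto.mul_const hlim (Or.inr hK)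
  simp only [intervalIntegral.integral_of_le hx]
  exact tendsto_integral_of_L1' h (hintegrable hh).1
    (Eventually.of_forall fun n => hintegrable (hH n)) hlim₁

theorem HardyAC0.eq_integral_deriv {f : ℝ → ℝ} (hf : f ∈ HardyAC0) {x : ℝ} (hx : 0 ≤ x) :
    f x = ∫ t in (0 : ℝ)..x, deriv f t := by
  rw [(hf.2 x hx).integral_deriv_eq_sub, hf.1, sub_zero]

theorem eLpNorm_primitive_abs_le {p q : ℝ} (hp : 1 ≤ p) {μ : Measure ℝ} (hμ : ∀ᵐ x ∂μ, 0 < x)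
    {C : ℝ≥0∞} (hC : C ≠ ∞) (hh : MemLp h (ENNReal.ofReal p) halfLebesgue)
    (hbound : ∀ H : ℝ → ℝ, Continuous H → (∀ x, 0 < H x) →
      eLpNorm (fun x => ∫ t in (0 : ℝ)..x, H t) (ENNReal.ofReal q) μ ≤
        C * eLpNorm H (ENNReal.ofReal p) halfLebesgue) :
    eLpNorm (fun x => ∫ t in (0 : ℝ)..x, |h t|) (ENNReal.ofReal q) μ ≤
      C * eLpNorm h (ENNReal.ofReal p) halfLebesgue := by
  have hp' : 1 ≤ ENNReal.ofReal p := ENNReal.one_le_ofReal.2 hp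
  obtain ⟨H, hcont, hpos, hmem, hlim⟩ :=
    exists_seq_continuous_pos_tendsto hp' ENNReal.ofReal_ne_top hh
  have htriangle (n : ℕ) : eLpNorm (H n) (ENNReal.ofReal p) halfLebesgue ≤
      eLpNorm (H n - fun x => |h x|) (ENNReal.ofReal p) halfLebesgue +
        eLpNorm h (ENNReal.ofReal p) halfLebesgue := by
    have := eLpNorm_add_le ((hmem n).sub hh.norm).1 hh.norm.1 hp'
    rwa [sub_add_cancel, eLpNorm_norm h] at this
  calc eLpNorm (fun x => ∫ t in (0 : ℝ)..x, |h t|) (ENNReal.ofReal q) μ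
      ≤ atTop.liminf fun n => eLpNorm (fun x => ∫ t in (0 : ℝ)..x, H n t) (ENNReal.ofReal q) μ := by
        refine Lp.eLpNorm_lim_le_liminf_eLpNorm (fun n => (intervalIntegral.continuous_primitive
          (fun a b => (hcont n).intervalIntegrable a b) 0).aestronglyMeasurable) _ ?_
        filter_upwards [hμ] with x hx
          using tendsto_intervalIntegral_of_tendsto_eLpNorm hp' hx.le hmem hh.norm hlim
    _ ≤ atTop.liminf fun n => C *
          (eLpNorm (H n - fun x => |h x|) (ENNReal.ofReal p) halfLebesgue +
            eLpNorm h (ENNReal.ofReal p) halfLebesgue) :=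
        liminf_le_liminf (Eventually.of_forall fun n => (hbound (H n) (hcont n) (hpos n)).trans
          (mul_le_mul_right (htriangle n) C))
    _ = C * eLpNorm h (ENNReal.ofReal p) halfLebesgue := by
        have := ENNReal.Tendsto.const_mul (hlim.add_const
          (eLpNorm h (ENNReal.ofReal p) halfLebesgue)) (Or.inr hC)
        rw [zero_add] at this
        exact this.liminf_eq

theorem hardyIneq_of_continuous {p q : ℝ} (hp : 1 ≤ p) {μ : Measure ℝ} (hμ : ∀ᵐ x ∂μ, 0 < x)
    {C : ℝ≥0∞} (hC0 : C ≠ 0) (hC : C ≠ ∞)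
    (hbound : ∀ H : ℝ → ℝ, Continuous H → (∀ x, 0 < H x) →
      eLpNorm (fun x => ∫ t in (0 : ℝ)..x, H t) (ENNReal.ofReal q) μ ≤
        C * eLpNorm H (ENNReal.ofReal p) halfLebesgue) :
    HardyIneq p q μ halfLebesgue C := by
  intro f hf
  by_cases hE : eLpNorm (deriv f) (ENNReal.ofReal p) halfLebesgue = ∞
  · rw [hE, ENNReal.mul_top hC0]
    exact le_top
  have hmem : MemLp (deriv f) (ENNReal.ofReal p) halfLebesgue :=
    ⟨(measurable_deriv f).aestronglyMeasurable, lt_top_iff_ne_top.2 hE⟩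
  refine (eLpNorm_mono_ae ?_).trans (eLpNorm_primitive_abs_le hp hμ hC hmem hbound)
  filter_upwards [hμ] with x hx
  rw [HardyAC0.eq_integral_deriv hf hx.le]
  exact (intervalIntegral.abs_integral_le_integral_abs hx.le).trans (le_abs_self _)

end Reduction

/-! ### From bounded intervals to norm inequalities -/

/-- The measure `x ^ (-m) dx` on `(0, ∞)`, in terms of which `blissMeasure p q` depends on its
exponents only through `m = q / p* + 1`. -/
noncomputable def powerMeasure (m : ℝ) : Measure ℝ :=
  halfLebesgue.withDensity fun x => ENNReal.ofReal (x ^ (-m))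

section PowerMeasure

variable {m r : ℝ} {f : ℝ → ℝ}

theorem blissMeasure_eq_powerMeasure (p q : ℝ) :
    blissMeasure p q = powerMeasure (q / p.conjExponent + 1) := by
  rw [blissMeasure, powerMeasure, neg_add', neg_div]

theorem ae_powerMeasure_pos (m : ℝ) : ∀ᵐ x ∂powerMeasure m, 0 < x :=
  (withDensity_absolutelyContinuous _ _).ae_le (ae_restrict_mem measurableSet_Ioi)

theorem setLIntegral_powerMeasure {s : Set ℝ} (hs : MeasurableSet s) (hs0 : s ⊆ Ioi 0)
    {F : ℝ → ℝ≥0∞} (hF : Measurable F) :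
    ∫⁻ x in s, F x ∂powerMeasure m = ∫⁻ x in s, ENNReal.ofReal (x ^ (-m)) * F x := by
  rw [powerMeasure, halfLebesgue, restrict_withDensity hs, Measure.restrict_restrict hs,
    inter_eq_left.2 hs0, lintegral_withDensity_eq_lintegral_mul _ (by fun_prop) hF]
  rfl

theorem lintegral_powerMeasure {F : ℝ → ℝ≥0∞} (hF : Measurable F) :
    ∫⁻ x, F x ∂powerMeasure m = ∫⁻ x in Ioi 0, ENNReal.ofReal (x ^ (-m)) * F x := by
  rw [← setLIntegral_powerMeasure measurableSet_Ioi subset_rfl hF,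
    Measure.restrict_eq_self_of_ae_mem (s := Ioi 0) (ae_powerMeasure_pos m)]

theorem eLpNorm_ofReal_eq (hr : 0 < r) (f : ℝ → ℝ) (μ : Measure ℝ) :
    eLpNorm f (ENNReal.ofReal r) μ = (∫⁻ x, ENNReal.ofReal (|f x| ^ r) ∂μ) ^ (1 / r) := by
  rw [eLpNorm_eq_lintegral_rpow_enorm_toReal (ENNReal.ofReal_pos.2 hr).ne' ENNReal.ofReal_ne_top,
    ENNReal.toReal_ofReal hr.le]
  simp only [Real.enorm_eq_ofReal_abs, ENNReal.ofReal_rpow_of_nonneg (abs_nonneg _) hr.le]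

theorem eLpNorm_halfLebesgue (hr : 0 < r) (hf0 : ∀ x, 0 < x → 0 ≤ f x) :
    eLpNorm f (ENNReal.ofReal r) halfLebesgue =
      (∫⁻ x in Ioi 0, ENNReal.ofReal (f x ^ r)) ^ (1 / r) := by
  rw [eLpNorm_ofReal_eq hr, halfLebesgue]
  congr 1
  refine setLIntegral_congr_fun measurableSet_Ioi fun x hx => ?_
  rw [abs_of_nonneg (hf0 x hx)]

theorem eLpNorm_powerMeasure (hr : 0 < r) (hf : Measurable f) (hf0 : ∀ x, 0 < x → 0 ≤ f x) :
    eLpNorm f (ENNReal.ofReal r) (powerMeasure m) =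
      (∫⁻ x in Ioi 0, ENNReal.ofReal (massDensity r m f x)) ^ (1 / r) := by
  rw [eLpNorm_ofReal_eq hr, lintegral_powerMeasure (by fun_prop)]
  congr 1
  refine setLIntegral_congr_fun measurableSet_Ioi fun x (hx : 0 < x) => ?_
  rw [abs_of_nonneg (hf0 x hx), mul_comm, ← ENNReal.ofReal_mul (Real.rpow_nonneg (hf0 x hx) r),
    massDensity]

end PowerMeasure

section Exhaustion

variable {m r s K : ℝ} {H : ℝ → ℝ}

theorem lintegral_Ioi_le_of_intervalIntegral_le {u : ℝ → ℝ} {R : ℝ≥0∞} (hu : Measurable u)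
    (hu0 : ∀ x, 0 < x → 0 ≤ u x) (hint : ∀ X, 0 < X → IntervalIntegrable u volume 0 X)
    (hle : ∀ X, 0 < X → ENNReal.ofReal (∫ x in (0 : ℝ)..X, u x) ≤ R) :
    ∫⁻ x in Ioi 0, ENNReal.ofReal (u x) ≤ R := by
  have hcover : AECover (volume.restrict (Ioi (0 : ℝ))) atTop (fun n : ℕ => Iic (n : ℝ)) :=
    aecover_Iic tendsto_natCast_atTop_atTop
  refine le_of_tendsto (hcover.lintegral_tendsto_of_countably_generated
    (f := fun x => ENNReal.ofReal (u x)) (by fun_prop)) ?_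
  filter_upwards [eventually_gt_atTop 0] with n hn
  have hn' : (0 : ℝ) < n := Nat.cast_pos.2 hn
  refine le_of_eq_of_le ?_ (hle n hn')
  rw [Measure.restrict_restrict measurableSet_Iic, Iic_inter_Ioi,
    intervalIntegral.integral_of_le hn'.le, ofReal_integral_eq_lintegral_ofReal
      ((intervalIntegrable_iff_integrableOn_Ioc_of_le hn'.le).1 (hint n hn'))]
  exact (ae_restrict_mem measurableSet_Ioc).mono fun t ht => hu0 t ht.1

theorem ofReal_intervalIntegral_le {u : ℝ → ℝ} {X : ℝ} (hX : 0 ≤ X) (hu : Continuous u)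
    (hu0 : ∀ x, 0 ≤ u x) :
    ENNReal.ofReal (∫ x in (0 : ℝ)..X, u x) ≤ ∫⁻ x in Ioi 0, ENNReal.ofReal (u x) := by
  rw [intervalIntegral.integral_of_le hX, ofReal_integral_eq_lintegral_ofReal
    ((intervalIntegrable_iff_integrableOn_Ioc_of_le hX).1 (hu.intervalIntegrable _ _))
    (Eventually.of_forall hu0)]
  exact lintegral_mono_set fun t ht => ht.1

theorem eLpNorm_primitive_le (hr : 0 < r) (hs : 0 < s) (hsm : -1 < s - m) (hK : 0 ≤ K)
    (hH : Continuous H) (hpos : ∀ x, 0 < H x)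
    (hle : ∀ X, 0 < X →
      ∫ x in (0 : ℝ)..X, massDensity s m (fun x => ∫ t in (0 : ℝ)..x, H t) x ≤
        K * (∫ x in (0 : ℝ)..X, H x ^ r) ^ (s / r)) :
    eLpNorm (fun x => ∫ t in (0 : ℝ)..x, H t) (ENNReal.ofReal s) (powerMeasure m) ≤
      ENNReal.ofReal (K ^ (1 / s)) * eLpNorm H (ENNReal.ofReal r) halfLebesgue := by
  set f : ℝ → ℝ := fun x => ∫ t in (0 : ℝ)..x, H t
  have hf : Continuous f :=
    intervalIntegral.continuous_primitive (fun a b => hH.intervalIntegrable a b) 0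
  have hf0 : ∀ x, 0 < x → 0 ≤ f x := fun x hx =>
    intervalIntegral.integral_nonneg hx.le fun t _ => (hpos t).le
  have hHr : ∀ x, 0 ≤ H x ^ r := fun x => Real.rpow_nonneg (hpos x).le r
  rw [eLpNorm_powerMeasure hs hf.measurable hf0, eLpNorm_halfLebesgue hr fun x _ => (hpos x).le]
  have hmass : ∫⁻ x in Ioi 0, ENNReal.ofReal (massDensity s m f x) ≤
      ENNReal.ofReal K * (∫⁻ x in Ioi 0, ENNReal.ofReal (H x ^ r)) ^ (s / r) := by
    refine lintegral_Ioi_le_of_intervalIntegral_le (measurable_massDensity s m hf)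
      (fun x hx => mul_nonneg (Real.rpow_nonneg (hf0 x hx) s) (Real.rpow_nonneg hx.le _))
      (fun X hX => ?_) fun X hX => (ENNReal.ofReal_le_ofReal (hle X hX)).trans ?_
    · obtain ⟨c, C, -, hC, hcC⟩ := exists_linear_bounds hH hpos hX
      exact intervalIntegrable_massDensity hs.le hsm hC.le hX.le hf (fun x hx => hf0 x hx.1)
        fun x hx => (hcC x hx).2
    · have henergy := intervalIntegral.integral_nonneg (μ := volume) hX.le fun x _ => hHr x
      rw [ENNReal.ofReal_mul hK, ← ENNReal.ofReal_rpow_of_nonneg henergy (by positivity)]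
      gcongr
      exact ofReal_intervalIntegral_le hX.le (hH.rpow_const fun x => Or.inr hr.le) hHr
  refine (ENNReal.rpow_le_rpow hmass (one_div_nonneg.2 hs.le)).trans_eq ?_
  rw [ENNReal.mul_rpow_of_nonneg _ _ (by positivity), ← ENNReal.rpow_mul,
    ENNReal.ofReal_rpow_of_nonneg hK (by positivity), div_mul_div_comm, mul_one, mul_comm r,
    div_mul_cancel_left₀ hs.ne', one_div r]

end Exhaustion

theorem hardyIneq_bliss {p q p' m γ n : ℝ} (e : BlissExponents p q p' m γ n)
    (hint : IntegrableOn (blissKernel γ n) (Ioi 0)) (hJ : 0 < ∫ t in Ioi 0, blissKernel γ n t) :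
    HardyIneq p q (powerMeasure m) halfLebesgue (ENNReal.ofReal
      (((∫ t in Ioi 0, blissKernel γ n t) ^ (1 - q / p) * (p' / q) ^ (q / p)) ^ (1 / q))) := by
  have := e.q_pos
  have := e.conj_pos
  refine hardyIneq_of_continuous e.one_lt_p.le (ae_powerMeasure_pos m)
    (ENNReal.ofReal_pos.2 (by positivity)).ne' ENNReal.ofReal_ne_top fun H hH hpos => ?_
  refine eLpNorm_primitive_le e.p_pos e.q_pos (by linarith [e.m_add_γ, e.γ_pos]) (by positivity)
    hH hpos fun X hX => (bliss_interval e hint hJ hH hpos hX).trans_eq ?_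
  rw [Real.mul_rpow (by positivity)
    (intervalIntegral.integral_nonneg hX.le fun x _ => Real.rpow_nonneg (hpos x).le p), mul_assoc]

/-! ### Hardy's inequality -/

section Hardy

variable {m : ℝ} {H : ℝ → ℝ}

theorem hardy_young {F h x : ℝ} (hm : 1 < m) (hF : 0 < F) (hh : 0 ≤ h) (hx : 0 < x) :
    F ^ m * x ^ (-m) +
        m / (m - 1) * (h * m * F ^ (m - 1) * x ^ (1 - m) + F ^ m * ((1 - m) * x ^ (1 - m - 1))) ≤
      (m / (m - 1)) ^ m * h ^ m := by
  have hm' : 0 < m - 1 := sub_pos.2 hm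
  have hyoung := Real.young_inequality_of_nonneg (a := m / (m - 1) * h) (b := (F / x) ^ (m - 1))
    (by positivity) (by positivity) (Real.HolderConjugate.conjExponent hm)
  rw [Real.conjExponent, ← Real.rpow_mul (by positivity), mul_div_cancel₀ _ hm'.ne',
    Real.mul_rpow (by positivity) hh] at hyoung
  have hratio (a : ℝ) : F ^ a * x ^ (-a) = (F / x) ^ a := by
    rw [Real.rpow_neg hx.le, ← div_eq_mul_inv, Real.div_rpow hF.le hx.le]
  rw [show 1 - m - 1 = -m by ring, mul_assoc (h * m), ← neg_sub m 1, mul_left_comm (F ^ m),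
    hratio m, hratio (m - 1)]
  calc (F / x) ^ m +
        m / (m - 1) * (h * m * (F / x) ^ (m - 1) + -(m - 1) * (F / x) ^ m)
      = m * (m / (m - 1) * h * (F / x) ^ (m - 1)) - (m - 1) * (F / x) ^ m := by
        field_simp
        ring
    _ ≤ m * ((m / (m - 1)) ^ m * h ^ m / m + (F / x) ^ m / (m / (m - 1))) -
          (m - 1) * (F / x) ^ m := by gcongr
    _ = (m / (m - 1)) ^ m * h ^ m := by
        field_simp
        ring

theorem tendsto_rpow_mul_rpow_one_sub {f : ℝ → ℝ} {C X : ℝ} (hm : 0 ≤ m) (hX : 0 < X)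
    (hC : 0 ≤ C) (hf0 : ∀ x ∈ Ioc 0 X, 0 ≤ f x) (hfC : ∀ x ∈ Ioc 0 X, f x ≤ C * x) :
    Tendsto (fun x => f x ^ m * x ^ (1 - m)) (𝓝[>] 0) (𝓝 0) := by
  have hlin : Tendsto (fun x => C ^ m * x) (𝓝[>] 0) (𝓝 0) :=
    ((continuous_const_mul (C ^ m)).tendsto' 0 0 (mul_zero _)).mono_left nhdsWithin_le_nhds
  refine squeeze_zero' ?_ ?_ hlin
  · filter_upwards [Ioc_mem_nhdsGT hX] with x hx
    exact mul_nonneg (Real.rpow_nonneg (hf0 x hx) m) (Real.rpow_nonneg hx.1.le _)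
  · filter_upwards [Ioc_mem_nhdsGT hX] with x hx
    calc f x ^ m * x ^ (1 - m) ≤ (C * x) ^ m * x ^ (1 - m) :=
          mul_le_mul_of_nonneg_right (Real.rpow_le_rpow (hf0 x hx) (hfC x hx) hm)
            (Real.rpow_nonneg hx.1.le _)
      _ = C ^ m * x := by
          rw [Real.mul_rpow hC hx.1.le, mul_assoc, ← Real.rpow_add hx.1, add_sub_cancel,
            Real.rpow_one]

theorem hardy_interval (hm : 1 < m) (hH : Continuous H) (hpos : ∀ x, 0 < H x) {X : ℝ}
    (hX : 0 < X) :
    ∫ x in (0 : ℝ)..X, massDensity m m (fun x => ∫ t in (0 : ℝ)..x, H t) x ≤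
      (m / (m - 1)) ^ m * ∫ x in (0 : ℝ)..X, H x ^ m := by
  have hm0 : 0 < m := one_pos.trans hm
  have : 0 < m - 1 := sub_pos.2 hm
  set f : ℝ → ℝ := fun x => ∫ t in (0 : ℝ)..x, H t
  have hfderiv (x : ℝ) : HasDerivAt f (H x) x := (hH.integral_hasStrictDerivAt 0 x).hasDerivAt
  have hf : Continuous f := continuous_iff_continuousAt.2 fun x => (hfderiv x).continuousAt
  obtain ⟨c, C, hc, hC, hcC⟩ := exists_linear_bounds hH hpos hX
  have hf0 : ∀ x ∈ Ioc 0 X, 0 < f x := fun x hx => (mul_pos hc hx.1).trans_le (hcC x hx).1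
  have hint := intervalIntegrable_massDensity (m := m) hm0.le (by linarith) hC.le hX.le hf
    (fun x hx => (hf0 x hx).le) fun x hx => (hcC x hx).2
  have hmass : Tendsto (fun x => ∫ t in (0 : ℝ)..x, massDensity m m f t) (𝓝[>] 0) (𝓝 0) :=
    tendsto_primitive_zero hX hint
  have hboundary := tendsto_rpow_mul_rpow_one_sub hm0.le hX hC.le (fun x hx => (hf0 x hx).le)
    fun x hx => (hcC x hx).2
  have hlim := hmass.add (hboundary.const_mul (m / (m - 1)))
  rw [mul_zero, add_zero] at hlim
  have hbound := le_integral_of_hasDerivAt_le_of_tendsto hX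
    (fun x hx => (hasDerivAt_integral_massDensity hm0.le hf hx.1 (hint.mono_set (uIcc_subset_uIcc
      left_mem_uIcc (uIcc_of_le hX.le ▸ Ioc_subset_Icc_self hx)))).add
      ((((hfderiv x).rpow_const (p := m) (Or.inl (hf0 x hx).ne')).mul
        ((hasDerivAt_id x).rpow_const (p := 1 - m) (Or.inl hx.1.ne'))).const_mul (m / (m - 1))))
    (fun x hx => by
      simpa only [id, one_mul, massDensity] using hardy_young hm (hf0 x hx) (hpos x).le hx.1)
    (((hH.rpow_const fun x => Or.inr hm0.le).const_mul _).intervalIntegrable 0 X) hlim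
  rw [intervalIntegral.integral_const_mul] at hbound
  have : 0 ≤ m / (m - 1) * (f X ^ m * X ^ (1 - m)) := by
    have := hf0 X (right_mem_Ioc.2 hX)
    positivity
  exact (le_add_of_nonneg_right this).trans hbound

theorem hardyIneq_powerMeasure_self (hm : 1 < m) :
    HardyIneq m m (powerMeasure m) halfLebesgue (ENNReal.ofReal (m / (m - 1))) := by
  have hm0 : 0 < m := one_pos.trans hm
  have hm' : 0 < m / (m - 1) := div_pos hm0 (sub_pos.2 hm)
  refine hardyIneq_of_continuous hm.le (ae_powerMeasure_pos m) (ENNReal.ofReal_pos.2 hm').ne'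
    ENNReal.ofReal_ne_top fun H hH hpos => ?_
  have := eLpNorm_primitive_le (m := m) hm0 hm0 (by linarith) (Real.rpow_nonneg hm'.le m) hH hpos
    fun X hX => by
      rw [div_self hm0.ne', Real.rpow_one]
      exact hardy_interval hm hH hpos hX
  rwa [← Real.rpow_mul hm'.le, mul_one_div_cancel hm0.ne', Real.rpow_one] at this

end Hardy

/-! ### Beta integrals -/

section BetaIntegral

theorem setLIntegral_ofReal_of_integral_eq {α : Type*} [MeasurableSpace α] {μ : Measure α}
    {s : Set α} (hs : MeasurableSet s) {f : α → ℝ} (hf : ∀ x ∈ s, 0 ≤ f x) {c : ℝ} (hc : c ≠ 0)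
    (h : ∫ x in s, f x ∂μ = c) : ∫⁻ x in s, ENNReal.ofReal (f x) ∂μ = ENNReal.ofReal c := by
  rw [← h, ofReal_integral_eq_lintegral_ofReal (.of_integral_ne_zero (h ▸ hc))
    (ae_restrict_of_forall_mem hs hf)]

theorem lintegral_rpow_mul_exp_neg_mul {n r : ℝ} (hn : 0 < n) (hr : 0 < r) :
    ∫⁻ y in Ioi 0, ENNReal.ofReal (y ^ (n - 1) * Real.exp (-(r * y))) =
      ENNReal.ofReal ((1 / r) ^ n * Real.Gamma n) := by
  have := Real.Gamma_pos_of_pos hn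
  exact setLIntegral_ofReal_of_integral_eq measurableSet_Ioi
    (fun y hy => mul_nonneg (Real.rpow_nonneg (mem_Ioi.1 hy).le _) (Real.exp_nonneg _))
    (by positivity) (Real.integral_rpow_mul_exp_neg_mul_Ioi hn hr)

theorem lintegral_rpow_mul_exp_neg_mul_rpow {d γ b : ℝ} (hd : -1 < d) (hγ : 0 < γ) (hb : 0 < b) :
    ∫⁻ s in Ioi 0, ENNReal.ofReal (s ^ d * Real.exp (-b * s ^ γ)) =
      ENNReal.ofReal (b ^ (-(d + 1) / γ) * (1 / γ) * Real.Gamma ((d + 1) / γ)) := by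
  have := Real.Gamma_pos_of_pos (div_pos (neg_lt_iff_pos_add.1 hd) hγ)
  exact setLIntegral_ofReal_of_integral_eq measurableSet_Ioi
    (fun s hs => mul_nonneg (Real.rpow_nonneg (mem_Ioi.1 hs).le _) (Real.exp_nonneg _))
    (by positivity) (integral_rpow_mul_exp_neg_mul_rpow hγ hd hb)

variable {d γ n β : ℝ}

theorem ofReal_one_add_rpow_neg_mul_Gamma {s : ℝ} (hn : 0 < n) (hβ : 0 < β) (hs : 0 < s) :
    ENNReal.ofReal (s ^ d * (1 + β * s ^ γ) ^ (-n)) * ENNReal.ofReal (Real.Gamma n) =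
      ∫⁻ y in Ioi 0, ENNReal.ofReal (y ^ (n - 1) * Real.exp (-y)) *
        ENNReal.ofReal (s ^ d * Real.exp (-(β * y) * s ^ γ)) := by
  have hr : 0 < 1 + β * s ^ γ := by positivity
  calc ENNReal.ofReal (s ^ d * (1 + β * s ^ γ) ^ (-n)) * ENNReal.ofReal (Real.Gamma n)
      = ENNReal.ofReal (s ^ d) *
          ENNReal.ofReal ((1 / (1 + β * s ^ γ)) ^ n * Real.Gamma n) := by
        rw [one_div, Real.inv_rpow hr.le, ← Real.rpow_neg hr.le,
          ← ENNReal.ofReal_mul (by positivity), ← ENNReal.ofReal_mul (by positivity), mul_assoc]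
    _ = ∫⁻ y in Ioi 0, ENNReal.ofReal (s ^ d) *
          ENNReal.ofReal (y ^ (n - 1) * Real.exp (-((1 + β * s ^ γ) * y))) := by
        rw [lintegral_const_mul _ (by fun_prop), lintegral_rpow_mul_exp_neg_mul hn hr]
    _ = _ := by
        refine setLIntegral_congr_fun measurableSet_Ioi fun y (hy : 0 < y) => ?_
        rw [← ENNReal.ofReal_mul (by positivity), ← ENNReal.ofReal_mul (by positivity),
          show -((1 + β * s ^ γ) * y) = -y + -(β * y) * s ^ γ by ring, Real.exp_add]
        congr 1
        ring

/-- The Gamma integral for `(1 + β s ^ γ) ^ (-n)` turns the left-hand side into a double integral,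
in which the integration over `s` comes first after Fubini. -/
theorem lintegral_rpow_mul_one_add_mul_rpow (hd : -1 < d) (hγ : 0 < γ) (hdn : (d + 1) / γ < n)
    (hβ : 0 < β) :
    ∫⁻ s in Ioi 0, ENNReal.ofReal (s ^ d * (1 + β * s ^ γ) ^ (-n)) =
      ENNReal.ofReal (β ^ (-(d + 1) / γ) * (1 / γ) * Real.Gamma ((d + 1) / γ) *
        Real.Gamma (n - (d + 1) / γ) / Real.Gamma n) := by
  have hdγ : 0 < (d + 1) / γ := div_pos (neg_lt_iff_pos_add.1 hd) hγ
  have hn : 0 < n := hdγ.trans hdn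
  have := Real.Gamma_pos_of_pos hdγ
  have hΓn := Real.Gamma_pos_of_pos hn
  set c := β ^ (-(d + 1) / γ) * (1 / γ) * Real.Gamma ((d + 1) / γ)
  have hc : 0 < c := by positivity
  have hinner : ∀ y ∈ Ioi (0 : ℝ),
      (∫⁻ s in Ioi 0, ENNReal.ofReal (y ^ (n - 1) * Real.exp (-y)) *
        ENNReal.ofReal (s ^ d * Real.exp (-(β * y) * s ^ γ))) =
      ENNReal.ofReal c * ENNReal.ofReal (y ^ (n - (d + 1) / γ - 1) * Real.exp (-(1 * y))) := by
    intro y (hy : 0 < y)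
    rw [lintegral_const_mul _ (by fun_prop),
      lintegral_rpow_mul_exp_neg_mul_rpow hd hγ (mul_pos hβ hy),
      ← ENNReal.ofReal_mul (by positivity), ← ENNReal.ofReal_mul hc.le,
      Real.mul_rpow hβ.le hy.le, show n - (d + 1) / γ - 1 = (n - 1) + -(d + 1) / γ by ring,
      Real.rpow_add hy, one_mul]
    congr 1
    ring
  have hdouble : (∫⁻ s in Ioi 0, ENNReal.ofReal (s ^ d * (1 + β * s ^ γ) ^ (-n))) *
      ENNReal.ofReal (Real.Gamma n) =
      ENNReal.ofReal c * ENNReal.ofReal (Real.Gamma (n - (d + 1) / γ)) := by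
    rw [← lintegral_mul_const _ (by fun_prop), setLIntegral_congr_fun measurableSet_Ioi
      fun s hs => ofReal_one_add_rpow_neg_mul_Gamma hn hβ hs, lintegral_lintegral_swap
      (by simp only [Function.uncurry_def]; fun_prop), setLIntegral_congr_fun measurableSet_Ioi
      hinner, lintegral_const_mul _ (by fun_prop),
      lintegral_rpow_mul_exp_neg_mul (sub_pos.2 hdn) one_pos, div_one, Real.one_rpow, one_mul]
  rw [ENNReal.ofReal_div_of_pos hΓn, ENNReal.ofReal_mul hc.le, ← hdouble,
    ENNReal.mul_div_cancel_right (ENNReal.ofReal_pos.2 hΓn).ne' ENNReal.ofReal_ne_top]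

end BetaIntegral

/-! ### Bliss' inequality -/

/-- The energy `∫₀^∞ (1 + s ^ γ) ^ (-n) ds` of the extremal function, with `γ = q / p - 1` and
`n = p q / (q - p)`; it is the reciprocal of the base of the power `k_{q,p}`. -/
noncomputable def blissEnergy (p q : ℝ) : ℝ :=
  Real.Gamma (q / (q - p)) * Real.Gamma (p * (q - 1) / (q - p)) / Real.Gamma (p * q / (q - p))

section BlissEnergy

variable {p q p' m γ n β : ℝ} (e : BlissExponents p q p' m γ n)
include e

theorem blissEnergy_pos : 0 < blissEnergy p q := by
  have := e.p_pos
  have := e.q_pos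
  have := e.q_sub_p_pos
  have : 0 < q - 1 := by linarith [e.one_lt_p]
  have := Real.Gamma_pos_of_pos (show 0 < q / (q - p) by positivity)
  have := Real.Gamma_pos_of_pos (show 0 < p * (q - 1) / (q - p) by positivity)
  have := Real.Gamma_pos_of_pos (show 0 < p * q / (q - p) by positivity)
  rw [blissEnergy]
  positivity

theorem sharpFactor_eq_blissEnergy_rpow :
    sharpFactor p q = blissEnergy p q ^ (-(1 / p - 1 / q)) := by
  rw [Real.rpow_neg (blissEnergy_pos e).le, ← Real.inv_rpow (blissEnergy_pos e).le,
    sharpFactor, blissEnergy, inv_div]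

theorem sharpFactor_pos : 0 < sharpFactor p q := by
  rw [sharpFactor_eq_blissEnergy_rpow e]
  exact Real.rpow_pos_of_pos (blissEnergy_pos e) _

theorem lintegral_one_add_rpow_eq_blissEnergy (hβ : 0 < β) :
    ∫⁻ s in Ioi 0, ENNReal.ofReal ((1 + β * s ^ γ) ^ (-n)) =
      ENNReal.ofReal (β ^ (-1 / γ) * blissEnergy p q) := by
  have := e.p_pos
  have := e.q_pos
  have := e.q_sub_p_pos
  have hγ : γ = (q - p) / p := by rw [e.γ_eq]; field_simp
  have hdγ : (0 + 1) / γ = p / (q - p) := by rw [hγ]; field_simp; ring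
  have hdn : (0 + 1) / γ < n := by
    rw [hdγ, e.n_eq]
    gcongr
    exact lt_mul_of_one_lt_right e.p_pos (e.one_lt_p.trans e.p_lt_q)
  have hbeta := lintegral_rpow_mul_one_add_mul_rpow (d := 0) (by norm_num) e.γ_pos hdn hβ
  simp only [Real.rpow_zero, one_mul] at hbeta
  rw [hbeta, show n - (0 + 1) / γ = p * (q - 1) / (q - p) by rw [hdγ, e.n_eq]; field_simp, hdγ,
    blissEnergy, show q / (q - p) = p / (q - p) + 1 by field_simp; ring,
    Real.Gamma_add_one (by positivity), e.n_eq, zero_add, hγ]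
  congr 1
  field_simp

theorem lintegral_rpow_mul_one_add_rpow_eq_blissEnergy (hβ : 0 < β) :
    ∫⁻ s in Ioi 0, ENNReal.ofReal (s ^ γ * (1 + β * s ^ γ) ^ (-n)) =
      ENNReal.ofReal (β ^ (-(γ + 1) / γ) * (p' / q * blissEnergy p q)) := by
  have := e.p_sub_one_pos
  have := e.p_pos
  have := e.q_pos
  have := e.q_sub_p_pos
  have hγ : γ = (q - p) / p := by rw [e.γ_eq]; field_simp
  have hdγ : (γ + 1) / γ = q / (q - p) := by rw [hγ]; field_simp; ring
  have hdn : (γ + 1) / γ < n := by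
    rw [hdγ, e.n_eq]
    gcongr
    exact lt_mul_of_one_lt_left e.q_pos e.one_lt_p
  rw [lintegral_rpow_mul_one_add_mul_rpow (by linarith [e.γ_pos]) e.γ_pos hdn hβ,
    show n - (γ + 1) / γ = q * (p - 1) / (q - p) by rw [hdγ, e.n_eq]; field_simp, hdγ,
    blissEnergy, show p * (q - 1) / (q - p) = q * (p - 1) / (q - p) + 1 by field_simp; ring,
    Real.Gamma_add_one (by positivity), e.n_eq, e.conj_eq,
    show 1 / γ = p / (q - p) by rw [hγ]; field_simp]
  congr 1
  field_simp

theorem integrableOn_blissKernel : IntegrableOn (blissKernel γ n) (Ioi 0) ∧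
    ∫ t in Ioi 0, blissKernel γ n t = p' / q * blissEnergy p q := by
  have hE : 0 ≤ p' / q * blissEnergy p q :=
    mul_nonneg (div_pos e.conj_pos e.q_pos).le (blissEnergy_pos e).le
  have hmeas : AEStronglyMeasurable (blissKernel γ n) (volume.restrict (Ioi 0)) :=
    (continuous_blissKernel e.γ_pos n).aestronglyMeasurable
  have hnonneg : 0 ≤ᵐ[volume.restrict (Ioi 0)] blissKernel γ n :=
    ae_restrict_of_forall_mem measurableSet_Ioi fun t ht => (blissKernel_pos (ne_of_gt ht)).le
  have hmass : ∫⁻ t in Ioi 0, ENNReal.ofReal (blissKernel γ n t) =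
      ENNReal.ofReal (p' / q * blissEnergy p q) := by
    have := lintegral_rpow_mul_one_add_rpow_eq_blissEnergy e one_pos
    simp only [Real.one_rpow, one_mul] at this
    rw [← this]
    exact setLIntegral_congr_fun measurableSet_Ioi fun t ht => by rw [blissKernel_of_pos ht]
  refine ⟨(lintegral_ofReal_ne_top_iff_integrable hmeas hnonneg).1 ?_, ?_⟩
  · rw [hmass]
    exact ENNReal.ofReal_ne_top
  · rw [integral_eq_lintegral_of_nonneg_ae hnonneg hmeas, hmass, ENNReal.toReal_ofReal hE]

theorem bliss_inequality :
    HardyIneq p q (powerMeasure m) halfLebesgue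
      (ENNReal.ofReal ((p' / q) ^ (1 / q) * sharpFactor p q)) := by
  have := e.p_pos
  have := e.q_pos
  have := e.conj_pos
  have hE := blissEnergy_pos e
  obtain ⟨hint, hmass⟩ := integrableOn_blissKernel e
  convert hardyIneq_bliss e hint (by rw [hmass]; positivity) using 2
  rw [hmass, sharpFactor_eq_blissEnergy_rpow e, Real.mul_rpow (by positivity) hE.le,
    mul_right_comm, ← Real.rpow_add (by positivity), sub_add_cancel, Real.rpow_one,
    Real.mul_rpow (by positivity) (by positivity), ← Real.rpow_mul hE.le]
  congr 2
  field_simp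
  ring

end BlissEnergy

/-! ### The optimal constant and the extremal functions -/

theorem hardyConst_le {p q : ℝ} {μ ν : Measure ℝ} {C : ℝ≥0∞} (h : HardyIneq p q μ ν C) :
    hardyConst p q μ ν ≤ C :=
  iSup₂_le fun f hf => ENNReal.div_le_of_le_mul (h f hf.1)

theorem le_hardyConst {p q : ℝ} {μ ν : Measure ℝ} {f : ℝ → ℝ} (hf : f ∈ HardyAC0)
    (hpos : 0 < eLpNorm (deriv f) (ENNReal.ofReal p) ν)
    (hfin : eLpNorm (deriv f) (ENNReal.ofReal p) ν < ∞) :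
    eLpNorm f (ENNReal.ofReal q) μ / eLpNorm (deriv f) (ENNReal.ofReal p) ν ≤
      hardyConst p q μ ν :=
  le_iSup₂_of_le (f := fun f (_ : f ∈ {f : ℝ → ℝ | f ∈ HardyAC0 ∧
      0 < eLpNorm (deriv f) (ENNReal.ofReal p) ν ∧ eLpNorm (deriv f) (ENNReal.ofReal p) ν < ∞}) =>
    eLpNorm f (ENNReal.ofReal q) μ / eLpNorm (deriv f) (ENNReal.ofReal p) ν) f
    ⟨hf, hpos, hfin⟩ le_rfl

theorem absolutelyContinuousOnInterval_congr {f g : ℝ → ℝ} {a b : ℝ} (h : EqOn f g (uIcc a b))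
    (hf : AbsolutelyContinuousOnInterval f a b) : AbsolutelyContinuousOnInterval g a b := by
  refine Tendsto.congr' (eventually_inf_principal.2 (.of_forall fun E hE => ?_)) hf
  exact Finset.sum_congr rfl fun i hi => by rw [h (hE.1 i hi).1, h (hE.1 i hi).2]

theorem HardyAC0.of_hasDerivAt_nonneg {f f' : ℝ → ℝ} (hf0 : f 0 = 0)
    (hf : ContinuousOn f (Ici 0)) (hderiv : ∀ x, 0 < x → HasDerivAt f (f' x) x)
    (hnonneg : ∀ x, 0 < x → 0 ≤ f' x) : f ∈ HardyAC0 := by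
  have hcont (b : ℝ) : ContinuousOn f (Icc 0 b) := hf.mono Icc_subset_Ici_self
  have hint (b : ℝ) (hb : 0 ≤ b) : IntervalIntegrable f' volume 0 b :=
    (intervalIntegrable_iff_integrableOn_Ioc_of_le hb).2 <|
      intervalIntegral.integrableOn_deriv_of_nonneg (hcont b) (fun x hx => hderiv x hx.1)
        fun x hx => hnonneg x hx.1
  refine ⟨hf0, fun b hb => absolutelyContinuousOnInterval_congr (fun x hx => ?_)
    ((hint b hb).absolutelyContinuousOnInterval_intervalIntegral left_mem_uIcc)⟩
  rw [uIcc_of_le hb] at hx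
  rw [intervalIntegral.integral_eq_sub_of_hasDerivAt_of_le hx.1 (hcont x)
    (fun y hy => hderiv y hy.1) (hint x hx.1), hf0, sub_zero]

section Optimizers

theorem hasDerivAt_mul_div_one_add_rpow {γ α β x : ℝ} (hγ : γ ≠ 0) (hβ : 0 ≤ β) (hx : 0 < x) :
    HasDerivAt (fun y : ℝ => α * y / (1 + β * y ^ γ) ^ (1 / γ))
      (α / (β * x ^ γ + 1) ^ ((γ + 1) / γ)) x := by
  have hz : 0 < 1 + β * x ^ γ := by positivity
  have hroot : HasDerivAt (fun y : ℝ => (1 + β * y ^ γ) ^ (1 / γ))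
      (β * x ^ (γ - 1) * (1 + β * x ^ γ) ^ (1 / γ - 1)) x := by
    refine ((((Real.hasDerivAt_rpow_const (.inl hx.ne')).const_mul β).const_add 1).rpow_const
      (p := 1 / γ) (.inl hz.ne')).congr_deriv ?_
    field_simp
  refine (((hasDerivAt_id x).const_mul α).div hroot (by positivity)).congr_deriv ?_
  rw [add_div, div_self hγ, add_comm (β * _) 1, Real.rpow_add hz, Real.rpow_one,
    Real.rpow_sub_one hx.ne', Real.rpow_sub_one hz.ne']
  have : 0 < (1 + β * x ^ γ) ^ (1 / γ) := by positivity
  simp only [id]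
  field_simp
  ring

variable {p q p' m γ n α β : ℝ} (e : BlissExponents p q p' m γ n)
include e

theorem hasDerivAt_blissFun (hβ : 0 < β) {x : ℝ} (hx : 0 < x) :
    HasDerivAt (blissFun p q α β) (α / (β * x ^ γ + 1) ^ ((γ + 1) / γ)) x := by
  obtain rfl := e.γ_eq
  exact hasDerivAt_mul_div_one_add_rpow e.γ_pos.ne' hβ.le hx

theorem blissFun_mem_HardyAC0 (hα : 0 < α) (hβ : 0 < β) : blissFun p q α β ∈ HardyAC0 := by
  refine HardyAC0.of_hasDerivAt_nonneg (by simp [blissFun]) ?_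
    (fun x hx => hasDerivAt_blissFun e hβ hx) fun x hx => by positivity
  obtain rfl := e.γ_eq
  have hbase : ∀ x ∈ Ici (0 : ℝ), 0 < 1 + β * x ^ (q / p - 1) := fun x (hx : 0 ≤ x) => by
    positivity
  have hpow : Continuous fun x : ℝ => x ^ (q / p - 1) := Real.continuous_rpow_const e.γ_pos.le
  have hcont : ContinuousOn (fun x : ℝ => 1 + β * x ^ (q / p - 1)) (Ici 0) :=
    (continuous_const.add (continuous_const.mul hpow)).continuousOn
  exact (continuous_const_mul α).continuousOn.div
    (hcont.rpow_const fun x hx => .inl (hbase x hx).ne')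
    fun x hx => (Real.rpow_pos_of_pos (hbase x hx) _).ne'

theorem eLpNorm_deriv_blissFun (hα : 0 < α) (hβ : 0 < β) :
    eLpNorm (deriv (blissFun p q α β)) (ENNReal.ofReal p) halfLebesgue =
      ENNReal.ofReal (α * (β ^ (-1 / γ) * blissEnergy p q) ^ (1 / p)) := by
  have hE := blissEnergy_pos e
  have hderiv : ∀ x, 0 < x → deriv (blissFun p q α β) x =
      α / (1 + β * x ^ γ) ^ ((γ + 1) / γ) := fun x hx => by
    rw [(hasDerivAt_blissFun e hβ hx).deriv, add_comm]
  have henergy : ∫⁻ x in Ioi 0, ENNReal.ofReal (deriv (blissFun p q α β) x ^ p) =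
      ENNReal.ofReal (α ^ p) * ENNReal.ofReal (β ^ (-1 / γ) * blissEnergy p q) := by
    rw [← lintegral_one_add_rpow_eq_blissEnergy e hβ, ← lintegral_const_mul _ (by fun_prop)]
    refine setLIntegral_congr_fun measurableSet_Ioi fun x (hx : 0 < x) => ?_
    have hn : (γ + 1) / γ * p = n := by
      rw [div_mul_eq_mul_div, e.γ_add_one_mul_p, ← e.n_mul_γ, mul_div_cancel_right₀ _ e.γ_pos.ne']
    rw [hderiv x hx, ← ENNReal.ofReal_mul (by positivity), Real.div_rpow hα.le (by positivity),
      ← Real.rpow_mul (by positivity), hn, Real.rpow_neg (by positivity), div_eq_mul_inv]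
  rw [eLpNorm_halfLebesgue e.p_pos fun x hx => by rw [hderiv x hx]; positivity, henergy,
    ← ENNReal.ofReal_mul (by positivity), ENNReal.ofReal_rpow_of_nonneg (by positivity)
    (one_div_nonneg.2 e.p_pos.le), Real.mul_rpow (by positivity) (by positivity),
    ← Real.rpow_mul hα.le, mul_one_div_cancel e.p_pos.ne', Real.rpow_one]

theorem massDensity_blissFun (hα : 0 < α) (hβ : 0 < β) {x : ℝ} (hx : 0 < x) :
    massDensity q m (blissFun p q α β) x = α ^ q * (x ^ γ * (1 + β * x ^ γ) ^ (-n)) := by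
  have hn : 1 / γ * q = n := by
    rw [← e.n_mul_γ, one_div_mul_eq_div, mul_div_cancel_right₀ _ e.γ_pos.ne']
  rw [massDensity, blissFun, ← e.γ_eq, Real.div_rpow (by positivity) (by positivity),
    Real.mul_rpow hα.le hx.le, ← Real.rpow_mul (by positivity), hn, Real.rpow_neg (by positivity) n,
    eq_sub_of_add_eq' e.m_add_γ, Real.rpow_sub hx, Real.rpow_neg hx.le]
  field_simp

theorem eLpNorm_blissFun (hα : 0 < α) (hβ : 0 < β) :
    eLpNorm (blissFun p q α β) (ENNReal.ofReal q) (powerMeasure m) =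
      ENNReal.ofReal (α * (β ^ (-(γ + 1) / γ) * (p' / q * blissEnergy p q)) ^ (1 / q)) := by
  have := e.q_pos
  have := e.conj_pos
  have hE := blissEnergy_pos e
  have hmass : ∫⁻ x in Ioi 0, ENNReal.ofReal (massDensity q m (blissFun p q α β) x) =
      ENNReal.ofReal (α ^ q) *
        ENNReal.ofReal (β ^ (-(γ + 1) / γ) * (p' / q * blissEnergy p q)) := by
    rw [← lintegral_rpow_mul_one_add_rpow_eq_blissEnergy e hβ,
      ← lintegral_const_mul _ (by fun_prop)]
    refine setLIntegral_congr_fun measurableSet_Ioi fun x hx => ?_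
    rw [massDensity_blissFun e hα hβ hx, ENNReal.ofReal_mul (by positivity)]
  have hmeas : Measurable (blissFun p q α β) := by unfold blissFun; fun_prop
  rw [eLpNorm_powerMeasure e.q_pos hmeas fun x hx => by unfold blissFun; positivity, hmass,
    ← ENNReal.ofReal_mul (by positivity), ENNReal.ofReal_rpow_of_nonneg (by positivity)
    (by positivity), Real.mul_rpow (by positivity) (by positivity), ← Real.rpow_mul hα.le,
    mul_one_div_cancel e.q_pos.ne', Real.rpow_one]

theorem eLpNorm_deriv_blissFun_pos (hα : 0 < α) (hβ : 0 < β) :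
    0 < eLpNorm (deriv (blissFun p q α β)) (ENNReal.ofReal p) halfLebesgue := by
  have := blissEnergy_pos e
  rw [eLpNorm_deriv_blissFun e hα hβ, ENNReal.ofReal_pos]
  positivity

theorem eLpNorm_deriv_blissFun_lt_top (hα : 0 < α) (hβ : 0 < β) :
    eLpNorm (deriv (blissFun p q α β)) (ENNReal.ofReal p) halfLebesgue < ∞ :=
  eLpNorm_deriv_blissFun e hα hβ ▸ ENNReal.ofReal_lt_top

theorem eLpNorm_blissFun_eq_mul_eLpNorm_deriv (hα : 0 < α) (hβ : 0 < β) :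
    eLpNorm (blissFun p q α β) (ENNReal.ofReal q) (powerMeasure m) =
      ENNReal.ofReal ((p' / q) ^ (1 / q) * sharpFactor p q) *
        eLpNorm (deriv (blissFun p q α β)) (ENNReal.ofReal p) halfLebesgue := by
  have := e.p_pos
  have := e.q_pos
  have := e.conj_pos
  have := e.γ_pos
  have hE := blissEnergy_pos e
  have hexp : -(γ + 1) / γ * (1 / q) = -1 / γ * (1 / p) := by
    rw [← e.γ_add_one_mul_p]
    field_simp
  rw [eLpNorm_blissFun e hα hβ, eLpNorm_deriv_blissFun e hα hβ, ← ENNReal.ofReal_mul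
    (mul_nonneg (by positivity) (sharpFactor_pos e).le), sharpFactor_eq_blissEnergy_rpow e]
  congr 1
  rw [Real.mul_rpow (by positivity) (by positivity), Real.mul_rpow (by positivity) hE.le,
    Real.mul_rpow (by positivity) hE.le, ← Real.rpow_mul hβ.le, ← Real.rpow_mul hβ.le, hexp,
    show blissEnergy p q ^ (1 / q) = blissEnergy p q ^ (-(1 / p - 1 / q)) *
      blissEnergy p q ^ (1 / p) by rw [← Real.rpow_add hE]; ring_nf]
  ring

theorem hardyConst_powerMeasure :
    hardyConst p q (powerMeasure m) halfLebesgue =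
      ENNReal.ofReal ((p' / q) ^ (1 / q) * sharpFactor p q) := by
  refine le_antisymm (hardyConst_le (bliss_inequality e)) ?_
  have hpos := eLpNorm_deriv_blissFun_pos e one_pos one_pos
  have hfin := eLpNorm_deriv_blissFun_lt_top e one_pos one_pos
  refine le_of_eq_of_le ?_ (le_hardyConst (blissFun_mem_HardyAC0 e one_pos one_pos) hpos hfin)
  rw [eLpNorm_blissFun_eq_mul_eLpNorm_deriv e one_pos one_pos,
    ENNReal.mul_div_cancel_right hpos.ne' hfin.ne]

theorem isLeast_hardyConst_powerMeasure :
    IsLeast {C | HardyIneq p q (powerMeasure m) halfLebesgue C}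
      (hardyConst p q (powerMeasure m) halfLebesgue) :=
  ⟨hardyConst_powerMeasure e ▸ bliss_inequality e, fun _ => hardyConst_le⟩

theorem eLpNorm_blissFun_eq_hardyConst_mul (hα : 0 < α) (hβ : 0 < β) :
    eLpNorm (blissFun p q α β) (ENNReal.ofReal q) (powerMeasure m) =
      hardyConst p q (powerMeasure m) halfLebesgue *
        eLpNorm (deriv (blissFun p q α β)) (ENNReal.ofReal p) halfLebesgue :=
  hardyConst_powerMeasure e ▸ eLpNorm_blissFun_eq_mul_eLpNorm_deriv e hα hβ

end Optimizers

/-! ### The constant `B` and the upper approximating sequence -/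

theorem setLIntegral_hardyHat_mul (p x : ℝ) (G : ℝ → ℝ≥0∞) :
    ∫⁻ y in Ioo 0 x, hardyHat p halfLebesgue y * G y = ∫⁻ y in Ioo 0 x, G y := by
  refine lintegral_congr_ae ?_
  have h := Measure.rnDeriv_restrict_self (volume : Measure ℝ) (measurableSet_Ioi (a := (0 : ℝ)))
  filter_upwards [ae_restrict_of_ae h, ae_restrict_mem measurableSet_Ioo] with y hy hy0
  rw [hardyHat, halfLebesgue, hy, indicator_of_mem (mem_Ioi.2 hy0.1), Pi.one_apply,
    ENNReal.one_rpow, one_mul]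

theorem hardyPhi_halfLebesgue (p x : ℝ) : hardyPhi p halfLebesgue x = ENNReal.ofReal x := by
  have h := setLIntegral_hardyHat_mul p x fun _ => 1
  simp only [mul_one] at h
  rw [hardyPhi, h, setLIntegral_one, Real.volume_Ioo, sub_zero]

theorem setLIntegral_Ioo_rpow {a x : ℝ} (ha : -1 < a) (hx : 0 < x) :
    ∫⁻ z in Ioo 0 x, ENNReal.ofReal (z ^ a) = ENNReal.ofReal (x ^ (a + 1) / (a + 1)) := by
  have ha1 : 0 < a + 1 := neg_lt_iff_pos_add.1 ha
  refine setLIntegral_ofReal_of_integral_eq measurableSet_Ioo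
    (fun z hz => Real.rpow_nonneg hz.1.le a) (by positivity) ?_
  rw [← integral_Ioc_eq_integral_Ioo, ← intervalIntegral.integral_of_le hx.le,
    integral_rpow (.inl ha), Real.zero_rpow ha1.ne', sub_zero]

theorem setLIntegral_Ioi_rpow_powerMeasure {a m y : ℝ} (ha : a < m - 1) (hy : 0 < y) :
    ∫⁻ z in Ioi y, ENNReal.ofReal (z ^ a) ∂powerMeasure m =
      ENNReal.ofReal (y ^ (a - m + 1) / (m - 1 - a)) := by
  have : 0 < m - 1 - a := sub_pos.2 ha
  rw [setLIntegral_powerMeasure measurableSet_Ioi (Ioi_subset_Ioi hy.le) (by fun_prop),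
    ← setLIntegral_ofReal_of_integral_eq (f := fun z => z ^ (a - m)) measurableSet_Ioi
      (fun z hz => Real.rpow_nonneg (hy.trans hz).le _) (by positivity)]
  · refine setLIntegral_congr_fun measurableSet_Ioi fun z hz => ?_
    have hz0 : 0 < z := hy.trans hz
    rw [← ENNReal.ofReal_mul (by positivity), ← Real.rpow_add hz0, neg_add_eq_sub]
  · rw [integral_Ioi_rpow_of_lt (by linarith) hy, neg_div, ← div_neg]
    ring_nf

section UpperBounds

variable {p p' q : ℝ} (h : p.HolderConjugate p') (hq : 0 < q)
include h hq

theorem hardyB_powerMeasure :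
    hardyB p q (powerMeasure (q / p' + 1)) halfLebesgue = ENNReal.ofReal ((p' / q) ^ (1 / q)) := by
  have hp' := h.symm.pos
  have hterm : ∀ x ∈ Ioi (0 : ℝ), hardyPhi p halfLebesgue x ^ (1 / p.conjExponent) *
      powerMeasure (q / p' + 1) (Ioi x) ^ (1 / q) = ENNReal.ofReal ((p' / q) ^ (1 / q)) := by
    intro x (hx : 0 < x)
    have htail := setLIntegral_Ioi_rpow_powerMeasure (a := 0) (m := q / p' + 1)
      (by rw [add_sub_cancel_right]; positivity) hx
    simp only [Real.rpow_zero, ENNReal.ofReal_one, setLIntegral_one] at htail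
    rw [htail, hardyPhi_halfLebesgue, h.conjExponent_eq, add_sub_cancel_right, sub_zero,
      show 0 - (q / p' + 1) + 1 = -(q / p') by ring, ENNReal.ofReal_rpow_of_pos hx,
      ENNReal.ofReal_rpow_of_pos (by positivity), ← ENNReal.ofReal_mul (by positivity),
      Real.div_rpow (by positivity) (by positivity), ← Real.rpow_mul hx.le, mul_div_assoc',
      ← Real.rpow_add hx, show 1 / p' + -(q / p') * (1 / q) = 0 by field_simp; ring,
      Real.rpow_zero, one_div, ← Real.inv_rpow (by positivity), inv_div]
  rw [hardyB, biSup_congr hterm, biSup_const (nonempty_Ioi (a := (0 : ℝ)))]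

theorem setLIntegral_Ioi_const_mul_rpow_rpow {θ a y : ℝ} (hθ : θ = q / (p' + q)) (ha : 0 < a)
    (hy : 0 < y) :
    (∫⁻ z in Ioi y, ENNReal.ofReal (a * z ^ θ) ^ (q / p') ∂powerMeasure (q / p' + 1)) ^ (p' / q) =
      ENNReal.ofReal (a * θ⁻¹ ^ (p' / q)) * ENNReal.ofReal (y ^ (θ - 1)) := by
  have hp' := h.symm.pos
  have hθ0 : 0 < θ := by rw [hθ]; positivity
  have hθq : θ * (q / p') = q / p' - θ := by rw [hθ]; field_simp; ring
  have hpow : ∀ z ∈ Ioi y, ENNReal.ofReal (a * z ^ θ) ^ (q / p') =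
      ENNReal.ofReal (a ^ (q / p')) * ENNReal.ofReal (z ^ (q / p' - θ)) := fun z hz => by
    have hz0 : 0 < z := hy.trans hz
    rw [ENNReal.ofReal_rpow_of_pos (by positivity), Real.mul_rpow ha.le (by positivity),
      ← Real.rpow_mul hz0.le, hθq, ENNReal.ofReal_mul (by positivity)]
  rw [setLIntegral_congr_fun measurableSet_Ioi hpow, lintegral_const_mul _ (by fun_prop),
    setLIntegral_Ioi_rpow_powerMeasure (by linarith) hy,
    show q / p' - θ - (q / p' + 1) + 1 = -θ by ring,
    show q / p' + 1 - 1 - (q / p' - θ) = θ by ring, ← ENNReal.ofReal_mul (by positivity),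
    ENNReal.ofReal_rpow_of_pos (by positivity), ← ENNReal.ofReal_mul (by positivity),
    Real.mul_rpow (by positivity) (by positivity), Real.div_rpow (by positivity) hθ0.le,
    ← Real.rpow_mul ha.le, ← Real.rpow_mul hy.le, div_mul_div_cancel₀ hp'.ne', div_self hq.ne',
    Real.rpow_one, Real.inv_rpow hθ0.le, div_eq_inv_mul, mul_assoc]
  congr 4
  rw [hθ]
  field_simp
  ring

theorem setLIntegral_hardyHat_upperStep {θ a x : ℝ} (hθ : θ = q / (p' + q)) (ha : 0 < a)
    {F : ℝ → ℝ≥0∞} (hF : ∀ x, 0 < x → F x = ENNReal.ofReal (a * x ^ θ)) (hx : 0 < x) :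
    ∫⁻ y in Ioo 0 x, hardyHat p halfLebesgue y *
      (∫⁻ z in Ioi y, F z ^ (q / p') ∂powerMeasure (q / p' + 1)) ^ (p' / q) =
    ENNReal.ofReal (a * θ⁻¹ ^ (1 + p' / q) * x ^ θ) := by
  have hp' := h.symm.pos
  have hθ0 : 0 < θ := by rw [hθ]; positivity
  have hinner : ∀ y ∈ Ioo 0 x,
      (∫⁻ z in Ioi y, F z ^ (q / p') ∂powerMeasure (q / p' + 1)) ^ (p' / q) =
        ENNReal.ofReal (a * θ⁻¹ ^ (p' / q)) * ENNReal.ofReal (y ^ (θ - 1)) := fun y hy => by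
    rw [← setLIntegral_Ioi_const_mul_rpow_rpow h hq hθ ha hy.1,
      setLIntegral_congr_fun measurableSet_Ioi fun z hz => by rw [hF z (hy.1.trans hz)]]
  rw [setLIntegral_hardyHat_mul, setLIntegral_congr_fun measurableSet_Ioo hinner,
    lintegral_const_mul _ (by fun_prop), setLIntegral_Ioo_rpow (by linarith) hx,
    ← ENNReal.ofReal_mul (by positivity), sub_add_cancel, Real.rpow_add (by positivity),
    Real.rpow_one, div_eq_inv_mul]
  ring_nf

theorem upperSeq_powerMeasure {θ x : ℝ} (hθ : θ = q / (p' + q)) (n : ℕ) (hx : 0 < x) :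
    upperSeq p q (powerMeasure (q / p' + 1)) halfLebesgue (n + 1) x =
      ENNReal.ofReal ((θ⁻¹ ^ (1 + p' / q)) ^ n * x ^ θ) := by
  have hp' := h.symm.pos
  have hθ0 : 0 < θ := by rw [hθ]; positivity
  induction n generalizing x with
  | zero =>
    rw [upperSeq, hardyPhi_halfLebesgue, h.conjExponent_eq, ← hθ, pow_zero, one_mul,
      ENNReal.ofReal_rpow_of_pos hx]
  | succ n ih =>
    rw [upperSeq, h.conjExponent_eq, setLIntegral_hardyHat_upperStep h hq hθ (by positivity)
      (fun _ => ih) hx, pow_succ]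

theorem upperRatio_powerMeasure {n : ℕ} (hn : 1 ≤ n) :
    upperRatio p q (powerMeasure (q / p' + 1)) halfLebesgue n =
      ENNReal.ofReal ((1 + p' / q) ^ (1 / p' + 1 / q)) := by
  have hp' := h.symm.pos
  obtain ⟨k, rfl⟩ := Nat.exists_eq_add_of_le' hn
  obtain ⟨θ, hθ⟩ : ∃ θ, θ = q / (p' + q) := ⟨_, rfl⟩
  have hθ0 : 0 < θ := by rw [hθ]; positivity
  have hterm : ∀ x ∈ Ioi (0 : ℝ),
      upperSeq p q (powerMeasure (q / p' + 1)) halfLebesgue (k + 1 + 1) x /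
        upperSeq p q (powerMeasure (q / p' + 1)) halfLebesgue (k + 1) x =
      ENNReal.ofReal (θ⁻¹ ^ (1 + p' / q)) := fun x (hx : 0 < x) => by
    rw [upperSeq_powerMeasure h hq hθ _ hx, upperSeq_powerMeasure h hq hθ _ hx,
      ← ENNReal.ofReal_div_of_pos (by positivity), pow_succ']
    congr 1
    field_simp
  rw [upperRatio, biSup_congr hterm, biSup_const (nonempty_Ioi (a := (0 : ℝ))),
    h.conjExponent_eq, ENNReal.ofReal_rpow_of_pos (by positivity),
    ← Real.rpow_mul (by positivity), show θ⁻¹ = 1 + p' / q by rw [hθ]; field_simp; ring]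
  congr 2
  field_simp

theorem upperDelta_powerMeasure {n : ℕ} (hn : 1 ≤ n) :
    upperDelta p q (powerMeasure (q / p' + 1)) halfLebesgue n =
      ENNReal.ofReal ((1 + p' / q) ^ (1 / p' + 1 / q)) := by
  have hfin : upperRatio p q (powerMeasure (q / p' + 1)) halfLebesgue 1 < ∞ :=
    upperRatio_powerMeasure h hq le_rfl ▸ ENNReal.ofReal_lt_top
  rw [upperDelta, if_pos (.inr hfin), upperRatio_powerMeasure h hq hn]

end UpperBounds

/-! ### The lower bound -/

section LowerBound

variable {p q : ℝ} {x₀ : ℝ≥0∞} {x : ℝ}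

theorem lowerTest_halfLebesgue (p : ℝ) (x₀ : ℝ≥0∞) (x : ℝ) :
    lowerTest p halfLebesgue x₀ x = (min (ENNReal.ofReal x) x₀).toReal := by
  rw [lowerTest, hardyPhi_halfLebesgue,
    ENNReal.ofReal_toReal (min_lt_of_left_lt ENNReal.ofReal_lt_top).ne]

theorem deriv_lowerTest_of_lt (hx : 0 < x) (hxx₀ : ENNReal.ofReal x < x₀) :
    deriv (lowerTest p halfLebesgue x₀) x = 1 := by
  refine ((hasDerivAt_id x).congr_of_eventuallyEq ?_).deriv
  filter_upwards [lt_mem_nhds hx,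
    ENNReal.continuous_ofReal.continuousAt.eventually_lt_const hxx₀] with y hy hyx₀
  rw [lowerTest_halfLebesgue, min_eq_left hyx₀.le, ENNReal.toReal_ofReal hy.le, id]

theorem deriv_lowerTest_of_gt (hxx₀ : x₀ < ENNReal.ofReal x) :
    deriv (lowerTest p halfLebesgue x₀) x = 0 := by
  refine ((hasDerivAt_const x x₀.toReal).congr_of_eventuallyEq ?_).deriv
  filter_upwards [ENNReal.continuous_ofReal.continuousAt.eventually_const_lt hxx₀] with y hyx₀
  rw [lowerTest_halfLebesgue, min_eq_right hyx₀.le]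

theorem halfLebesgue_ofReal_lt (x₀ : ℝ≥0∞) : halfLebesgue {x | ENNReal.ofReal x < x₀} = x₀ := by
  have hmeas : MeasurableSet {x : ℝ | ENNReal.ofReal x < x₀} :=
    measurableSet_lt (by fun_prop) measurable_const
  rw [halfLebesgue, Measure.restrict_apply hmeas]
  rcases eq_or_ne x₀ ∞ with rfl | htop
  · simp
  · have hIoo : {x : ℝ | ENNReal.ofReal x < x₀} ∩ Ioi 0 = Ioo 0 x₀.toReal := by
      ext x
      simp only [mem_inter_iff, mem_ofPred_eq, mem_Ioi, mem_Ioo]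
      exact ⟨fun hx => ⟨hx.2, (ENNReal.ofReal_lt_iff_lt_toReal hx.2.le htop).1 hx.1⟩,
        fun hx => ⟨(ENNReal.ofReal_lt_iff_lt_toReal hx.1.le htop).2 hx.2, hx.1⟩⟩
    rw [hIoo, Real.volume_Ioo, sub_zero, ENNReal.ofReal_toReal htop]

theorem eLpNorm_deriv_lowerTest (hp : 0 < p) (x₀ : ℝ≥0∞) :
    eLpNorm (deriv (lowerTest p halfLebesgue x₀)) (ENNReal.ofReal p) halfLebesgue =
      x₀ ^ (1 / p) := by
  have hderiv : deriv (lowerTest p halfLebesgue x₀) =ᵐ[halfLebesgue]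
      {x | ENNReal.ofReal x < x₀}.indicator fun _ => 1 := by
    have hne : ∀ᵐ x ∂halfLebesgue, x ≠ x₀.toReal := ae_restrict_of_ae (Measure.ae_ne volume _)
    filter_upwards [ae_restrict_mem measurableSet_Ioi, hne] with x (hx : 0 < x) hxx₀
    rcases lt_trichotomy (ENNReal.ofReal x) x₀ with hlt | heq | hgt
    · rw [deriv_lowerTest_of_lt hx hlt, indicator_apply, if_pos (by exact hlt)]
    · exact absurd (by rw [← heq, ENNReal.toReal_ofReal hx.le]) hxx₀
    · rw [deriv_lowerTest_of_gt hgt, indicator_apply, if_neg (by exact hgt.not_gt)]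
  rw [eLpNorm_congr_ae hderiv, eLpNorm_indicator_const
    (measurableSet_lt (by fun_prop) measurable_const) (ENNReal.ofReal_pos.2 hp).ne'
    ENNReal.ofReal_ne_top, halfLebesgue_ofReal_lt, enorm_one, one_mul, ENNReal.toReal_ofReal hp.le]

theorem lintegral_massDensity_min {m a : ℝ} (hm : 1 < m) (hqm : m < q + 1) (ha : 0 < a) :
    ∫⁻ x in Ioi 0, ENNReal.ofReal (massDensity q m (fun x => min x a) x) =
      ENNReal.ofReal (a ^ (q - m + 1) * (1 / (q - m + 1) + 1 / (m - 1))) := by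
  have hleft : ∫⁻ x in Ioc 0 a, ENNReal.ofReal (massDensity q m (fun x => min x a) x) =
      ENNReal.ofReal (a ^ (q - m + 1) / (q - m + 1)) := by
    rw [← setLIntegral_Ioo_rpow (by linarith) ha, ← setLIntegral_congr Ioo_ae_eq_Ioc]
    refine setLIntegral_congr_fun measurableSet_Ioo fun x hx => ?_
    rw [massDensity, min_eq_left hx.2.le, ← Real.rpow_add hx.1, sub_eq_add_neg]
  have hright : ∫⁻ x in Ioi a, ENNReal.ofReal (massDensity q m (fun x => min x a) x) =
      ENNReal.ofReal (a ^ q) * ENNReal.ofReal (a ^ (0 - m + 1) / (m - 1 - 0)) := by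
    rw [← setLIntegral_Ioi_rpow_powerMeasure (by linarith) ha,
      setLIntegral_powerMeasure measurableSet_Ioi (Ioi_subset_Ioi ha.le) (by fun_prop),
      ← lintegral_const_mul _ (by fun_prop)]
    refine setLIntegral_congr_fun measurableSet_Ioi fun x hx => ?_
    rw [massDensity, min_eq_right (mem_Ioi.1 hx).le, Real.rpow_zero, ENNReal.ofReal_one, mul_one,
      ENNReal.ofReal_mul (by positivity)]
  have : 0 < m - 1 := sub_pos.2 hm
  have : 0 < q - m + 1 := by linarith
  rw [← Ioc_union_Ioi_eq_Ioi ha.le, lintegral_union measurableSet_Ioi (Ioc_disjoint_Ioi le_rfl),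
    hleft, hright, sub_zero, ← ENNReal.ofReal_mul (by positivity),
    ← ENNReal.ofReal_add (by positivity) (by positivity), mul_div_assoc', ← Real.rpow_add ha]
  ring_nf

variable {p' : ℝ} (h : p.HolderConjugate p') (hq : 0 < q)
include h hq

theorem eLpNorm_lowerTest {a : ℝ} (ha : 0 < a) :
    eLpNorm (lowerTest p halfLebesgue (ENNReal.ofReal a)) (ENNReal.ofReal q)
        (powerMeasure (q / p' + 1)) =
      ENNReal.ofReal ((p * p' / q) ^ (1 / q)) * ENNReal.ofReal a ^ (1 / p) := by
  have hp := h.pos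
  have hp' := h.symm.pos
  have hqp : q - (q / p' + 1) + 1 = q / p := by
    rw [div_eq_mul_inv q p', ← h.one_sub_inv]
    ring
  have hlower : EqOn (lowerTest p halfLebesgue (ENNReal.ofReal a)) (fun x => min x a) (Ioi 0) :=
    fun x hx => by
      rw [lowerTest_halfLebesgue, ← ENNReal.ofReal_min,
        ENNReal.toReal_ofReal (le_min (mem_Ioi.1 hx).le ha.le)]
  have hae : lowerTest p halfLebesgue (ENNReal.ofReal a) =ᵐ[powerMeasure (q / p' + 1)]
      fun x => min x a := (ae_powerMeasure_pos _).mono hlower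
  rw [eLpNorm_congr_ae hae, eLpNorm_powerMeasure hq (by fun_prop) fun x hx => le_min hx.le ha.le,
    lintegral_massDensity_min (by linarith [div_pos hq hp'])
      (by linarith [hqp, div_pos hq hp]) ha, hqp, add_sub_cancel_right, one_div_div, one_div_div,
    ← add_div, ← h.mul_eq_add, ENNReal.ofReal_rpow_of_pos (by positivity),
    ENNReal.ofReal_rpow_of_pos ha, ← ENNReal.ofReal_mul (by positivity),
    Real.mul_rpow (by positivity) (by positivity), ← Real.rpow_mul ha.le, mul_comm,
    div_mul_div_cancel₀' hq.ne']

theorem lowerDelta1_powerMeasure :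
    lowerDelta1 p q (powerMeasure (q / p' + 1)) halfLebesgue =
      ENNReal.ofReal ((p * p' / q) ^ (1 / q)) := by
  have hquot {a : ℝ} (ha : 0 < a) :
      eLpNorm (lowerTest p halfLebesgue (ENNReal.ofReal a)) (ENNReal.ofReal q)
          (powerMeasure (q / p' + 1)) /
        eLpNorm (deriv (lowerTest p halfLebesgue (ENNReal.ofReal a))) (ENNReal.ofReal p)
          halfLebesgue = ENNReal.ofReal ((p * p' / q) ^ (1 / q)) := by
    have ha' : 0 < ENNReal.ofReal a := ENNReal.ofReal_pos.2 ha
    rw [eLpNorm_lowerTest h hq ha, eLpNorm_deriv_lowerTest h.pos, ENNReal.mul_div_cancel_right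
      (ENNReal.rpow_pos ha' ENNReal.ofReal_ne_top).ne'
      (ENNReal.rpow_ne_top_of_nonneg (one_div_nonneg.2 h.nonneg) ENNReal.ofReal_ne_top)]
  refine le_antisymm (iSup₂_le fun x₀ hx₀ => ?_)
    (le_iSup₂_of_le (ENNReal.ofReal 1) (by simp) (hquot one_pos).ge)
  rcases eq_or_ne x₀ ∞ with rfl | htop
  · rw [eLpNorm_deriv_lowerTest h.pos, ENNReal.top_rpow_of_pos h.one_div_pos, ENNReal.div_top]
    exact zero_le
  · rw [← ENNReal.ofReal_toReal htop]
    exact (hquot (ENNReal.toReal_pos (ne_of_gt hx₀) htop)).le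

end LowerBound

/-! ### Sharpness of Hardy's inequality -/

section HardySharpness

variable {c m : ℝ}

theorem hasDerivAt_div_one_add_rpow (c : ℝ) {x : ℝ} (hx : 0 < x) :
    HasDerivAt (fun y : ℝ => (y / (1 + y)) ^ c) (c * (x ^ (c - 1) * (1 + x) ^ (-(c + 1)))) x := by
  have h1x : 0 < 1 + x := by positivity
  have hdiv : HasDerivAt (fun y : ℝ => y / (1 + y)) (1 / (1 + x) ^ 2) x :=
    ((hasDerivAt_id x).div ((hasDerivAt_id x).const_add 1) h1x.ne').congr_deriv <| by
      simp only [id, one_mul, mul_one, add_sub_cancel_right]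
  refine (hdiv.rpow_const (p := c) (.inl (by positivity))).congr_deriv ?_
  rw [Real.div_rpow hx.le h1x.le, show -(c + 1) = -(c - 1) - 2 by ring,
    Real.rpow_sub h1x (-(c - 1)) 2, Real.rpow_neg h1x.le, Real.rpow_two]
  field_simp

theorem div_one_add_rpow_mem_HardyAC0 (hc : 0 < c) :
    (fun x : ℝ => (x / (1 + x)) ^ c) ∈ HardyAC0 := by
  refine HardyAC0.of_hasDerivAt_nonneg (by simp [hc.ne'])
    ((continuousOn_id.div (by fun_prop) fun x hx => ?_).rpow_const fun x _ => .inr hc.le)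
    (fun x hx => hasDerivAt_div_one_add_rpow c hx) fun x hx => by positivity
  rw [mem_Ici] at hx
  positivity

theorem eLpNorm_deriv_div_one_add_rpow_pos_lt_top (hm : 1 < m) (hc : 1 - 1 / m < c) :
    0 < eLpNorm (deriv fun x : ℝ => (x / (1 + x)) ^ c) (ENNReal.ofReal m) halfLebesgue ∧
      eLpNorm (deriv fun x : ℝ => (x / (1 + x)) ^ c) (ENNReal.ofReal m) halfLebesgue < ∞ := by
  have hm0 : 0 < m := one_pos.trans hm
  have hc0 : 0 < c := lt_trans (sub_pos.2 ((div_lt_one hm0).2 hm)) hc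
  have hcm : -1 < (c - 1) * m := by
    have := mul_lt_mul_of_pos_right hc hm0
    rw [sub_mul, one_div_mul_cancel hm0.ne'] at this
    linarith
  have hdn : ((c - 1) * m + 1) / 1 < (c + 1) * m := by linarith
  have hderiv {x : ℝ} (hx : 0 < x) := (hasDerivAt_div_one_add_rpow c hx).deriv
  have henergy : ∫⁻ x in Ioi 0, ENNReal.ofReal (deriv (fun x : ℝ => (x / (1 + x)) ^ c) x ^ m) =
      ENNReal.ofReal (c ^ m) * ENNReal.ofReal (Real.Gamma ((c - 1) * m + 1) *
        Real.Gamma ((c + 1) * m - ((c - 1) * m + 1)) / Real.Gamma ((c + 1) * m)) := by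
    have hint := lintegral_rpow_mul_one_add_mul_rpow hcm one_pos hdn one_pos
    simp only [Real.one_rpow, div_one, one_mul, Real.rpow_one] at hint
    rw [← hint, ← lintegral_const_mul _ (by fun_prop)]
    refine setLIntegral_congr_fun measurableSet_Ioi fun x (hx : 0 < x) => ?_
    rw [hderiv hx, ← ENNReal.ofReal_mul (by positivity), Real.mul_rpow hc0.le (by positivity),
      Real.mul_rpow (by positivity) (by positivity), ← Real.rpow_mul hx.le,
      ← Real.rpow_mul (by positivity), neg_mul]
  rw [div_one] at hdn
  have := Real.Gamma_pos_of_pos (neg_lt_iff_pos_add.1 hcm)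
  have := Real.Gamma_pos_of_pos (sub_pos.2 hdn)
  have := Real.Gamma_pos_of_pos ((neg_lt_iff_pos_add.1 hcm).trans hdn)
  rw [eLpNorm_halfLebesgue hm0 fun x hx => by rw [hderiv hx]; positivity, henergy,
    ← ENNReal.ofReal_mul (by positivity), ENNReal.ofReal_rpow_of_pos (by positivity)]
  exact ⟨ENNReal.ofReal_pos.2 (by positivity), ENNReal.ofReal_lt_top⟩

theorem one_div_le_hardyConst_of_mul_deriv_le {f : ℝ → ℝ} (hm : 0 < m) (hc : 0 < c)
    (hf : f ∈ HardyAC0) (hpos : 0 < eLpNorm (deriv f) (ENNReal.ofReal m) halfLebesgue)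
    (hfin : eLpNorm (deriv f) (ENNReal.ofReal m) halfLebesgue < ∞) (hmeas : Measurable f)
    (hderiv : ∀ x, 0 < x → 0 ≤ deriv f x) (hle : ∀ x, 0 < x → x * deriv f x ≤ c * f x) :
    ENNReal.ofReal (1 / c) ≤ hardyConst m m (powerMeasure m) halfLebesgue := by
  have hf0 (x : ℝ) (hx : 0 < x) : 0 ≤ f x :=
    nonneg_of_mul_nonneg_right ((mul_nonneg hx.le (hderiv x hx)).trans (hle x hx)) hc
  refine le_trans ?_ (le_hardyConst hf hpos hfin)
  rw [ENNReal.le_div_iff_mul_le (.inl hpos.ne') (.inl hfin.ne), eLpNorm_halfLebesgue hm hderiv,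
    eLpNorm_powerMeasure hm hmeas hf0]
  have hconst : ENNReal.ofReal (1 / c) = ENNReal.ofReal ((1 / c) ^ m) ^ (1 / m) := by
    rw [ENNReal.ofReal_rpow_of_pos (by positivity), ← Real.rpow_mul (by positivity),
      mul_one_div_cancel hm.ne', Real.rpow_one]
  rw [hconst, ← ENNReal.mul_rpow_of_nonneg _ _ (by positivity),
    ← lintegral_const_mul _ ((measurable_deriv f).pow_const m).ennreal_ofReal]
  gcongr ?_ ^ _
  refine setLIntegral_mono' measurableSet_Ioi fun x (hx : 0 < x) => ?_
  rw [← ENNReal.ofReal_mul (by positivity), massDensity, Real.rpow_neg hx.le,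
    ← Real.inv_rpow hx.le, ← Real.mul_rpow (by positivity) (hderiv x hx),
    ← Real.mul_rpow (hf0 x hx) (by positivity)]
  have := hderiv x hx
  refine ENNReal.ofReal_le_ofReal (Real.rpow_le_rpow (by positivity) ?_ hm.le)
  rw [one_div_mul_eq_div, ← div_eq_mul_inv, div_le_div_iff₀ hc hx]
  linarith [hle x hx]

theorem one_div_le_hardyConst_powerMeasure_self (hm : 1 < m) (hc : 1 - 1 / m < c) :
    ENNReal.ofReal (1 / c) ≤ hardyConst m m (powerMeasure m) halfLebesgue := by
  have hm0 : 0 < m := one_pos.trans hm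
  have hc0 : 0 < c := lt_trans (sub_pos.2 ((div_lt_one hm0).2 hm)) hc
  obtain ⟨hpos, hfin⟩ := eLpNorm_deriv_div_one_add_rpow_pos_lt_top hm hc
  have hderiv {x : ℝ} (hx : 0 < x) := (hasDerivAt_div_one_add_rpow c hx).deriv
  refine one_div_le_hardyConst_of_mul_deriv_le hm0 hc0 (div_one_add_rpow_mem_HardyAC0 hc0) hpos hfin
    (by fun_prop) (fun x hx => by rw [hderiv hx]; positivity) fun x hx => ?_
  have h1x : 0 < 1 + x := by positivity
  calc x * deriv (fun x : ℝ => (x / (1 + x)) ^ c) x = c * ((x / (1 + x)) ^ c / (1 + x)) := by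
        rw [hderiv hx, Real.rpow_sub_one hx.ne', Real.rpow_neg h1x.le, Real.rpow_add_one h1x.ne',
          Real.div_rpow hx.le h1x.le]
        field_simp
    _ ≤ c * (x / (1 + x)) ^ c := by
        gcongr
        exact div_le_self (by positivity) (by linarith)

theorem hardyConst_powerMeasure_self (hm : 1 < m) :
    hardyConst m m (powerMeasure m) halfLebesgue = ENNReal.ofReal (m / (m - 1)) := by
  have hm0 : 0 < m := one_pos.trans hm
  have hm' : 0 < 1 - 1 / m := sub_pos.2 ((div_lt_one hm0).2 hm)
  refine le_antisymm (hardyConst_le (hardyIneq_powerMeasure_self hm)) ?_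
  have hlim : Tendsto (fun c : ℝ => ENNReal.ofReal (1 / c)) (𝓝[>] (1 - 1 / m))
      (𝓝 (ENNReal.ofReal (m / (m - 1)))) := by
    have hval : m / (m - 1) = 1 / (1 - 1 / m) := by
      have := sub_pos.2 hm
      field_simp
    rw [hval]
    exact ENNReal.tendsto_ofReal ((continuousAt_const.div continuousAt_id hm'.ne').tendsto.mono_left
      nhdsWithin_le_nhds)
  refine le_of_tendsto hlim ?_
  filter_upwards [self_mem_nhdsWithin] with c hc using one_div_le_hardyConst_powerMeasure_self hm hc

end HardySharpness

/-! ### Strictness: estimates for a quotient of Gamma values -/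

section GammaQuotient

variable {s t : ℝ}

theorem lintegral_rpow_mul_one_sub_rpow (hs : 0 < s) (ht : 0 < t) :
    ∫⁻ x in Ioo (0 : ℝ) 1, ENNReal.ofReal (x ^ (s - 1) * (1 - x) ^ (t - 1)) =
      ENNReal.ofReal (Real.Gamma s * Real.Gamma t / Real.Gamma (s + t)) := by
  have hbeta := ProbabilityTheory.beta_pos hs ht
  have hpdf := ProbabilityTheory.lintegral_betaPDF_eq_one hs ht
  have hnormal : ∀ x ∈ Ioo (0 : ℝ) 1, ENNReal.ofReal (x ^ (s - 1) * (1 - x) ^ (t - 1)) =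
      ENNReal.ofReal (ProbabilityTheory.beta s t) *
        ENNReal.ofReal (1 / ProbabilityTheory.beta s t * x ^ (s - 1) * (1 - x) ^ (t - 1)) :=
    fun x _ => by
      rw [← ENNReal.ofReal_mul hbeta.le]
      congr 1
      field_simp
  rw [setLIntegral_congr_fun measurableSet_Ioo hnormal, lintegral_const_mul _ (by fun_prop),
    ← ProbabilityTheory.lintegral_betaPDF, hpdf, mul_one, ProbabilityTheory.beta]

theorem continuous_rpow_mul_one_sub_rpow (hs : 0 ≤ s) (ht : 0 ≤ t) :
    Continuous fun x : ℝ => x ^ s * (1 - x) ^ t :=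
  (Real.continuous_rpow_const hs).mul
    ((continuous_const.sub continuous_id).rpow_const fun _ => .inr ht)

theorem lt_integral_rpow_mul_one_sub_rpow_of_left {x₀ : ℝ} (hs : 0 < s) (ht : 0 < t) (h0 : 0 < x₀)
    (h1 : x₀ < 1) :
    x₀ ^ s * (1 - x₀) ^ t * (x₀ / (s + t + 1)) < ∫ x in (0 : ℝ)..x₀, x ^ s * (1 - x) ^ t := by
  have h1x₀ : 0 < 1 - x₀ := sub_pos.2 h1
  have hint : ∫ x in (0 : ℝ)..x₀, x ^ (s + t) * (x₀ ^ (-t) * (1 - x₀) ^ t) =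
      x₀ ^ s * (1 - x₀) ^ t * (x₀ / (s + t + 1)) := by
    rw [intervalIntegral.integral_mul_const, integral_rpow (.inl (by linarith)),
      Real.zero_rpow (by linarith), sub_zero, Real.rpow_add_one h0.ne', Real.rpow_add h0,
      Real.rpow_neg h0.le]
    field_simp
  have hfactor {x : ℝ} (hx : 0 < x) : x ^ (s + t) * (x₀ ^ (-t) * (1 - x₀) ^ t) =
      x ^ s * (x / x₀ * (1 - x₀)) ^ t := by
    rw [Real.mul_rpow (by positivity) h1x₀.le, Real.div_rpow hx.le h0.le, Real.rpow_add hx,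
      Real.rpow_neg h0.le]
    ring
  rw [← hint]
  refine intervalIntegral.integral_lt_integral_of_continuousOn_of_le_of_exists_lt h0
    ((Real.continuous_rpow_const (by positivity)).mul continuous_const).continuousOn
    (continuous_rpow_mul_one_sub_rpow hs.le ht.le).continuousOn
    (fun x hx => ?_) ⟨x₀ / 2, ⟨by linarith, by linarith⟩, ?_⟩
  · have hx0 : 0 < x := hx.1
    rw [hfactor hx0]
    gcongr
    rw [div_mul_eq_mul_div, div_le_iff₀ h0]
    nlinarith [hx.2]
  · rw [hfactor (half_pos h0)]
    gcongr
    rw [div_mul_eq_mul_div, div_lt_iff₀ h0]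
    nlinarith

theorem lt_integral_rpow_mul_one_sub_rpow {x₀ : ℝ} (hs : 0 < s) (ht : 0 < t) (h0 : 0 < x₀)
    (h1 : x₀ < 1) :
    x₀ ^ s * (1 - x₀) ^ t / (s + t + 1) < ∫ x in (0 : ℝ)..1, x ^ s * (1 - x) ^ t := by
  have hcont := continuous_rpow_mul_one_sub_rpow hs.le ht.le
  have hleft := lt_integral_rpow_mul_one_sub_rpow_of_left hs ht h0 h1
  have hright := lt_integral_rpow_mul_one_sub_rpow_of_left ht hs (sub_pos.2 h1)
    (sub_lt_self 1 h0)
  have hreflect : ∫ x in x₀..1, x ^ s * (1 - x) ^ t =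
      ∫ x in (0 : ℝ)..(1 - x₀), x ^ t * (1 - x) ^ s := by
    have hcomp := intervalIntegral.integral_comp_sub_left (a := x₀) (b := 1)
      (fun x : ℝ => x ^ t * (1 - x) ^ s) 1
    simp only [sub_self, sub_sub_cancel] at hcomp
    simp only [← hcomp, mul_comm]
  rw [sub_sub_cancel] at hright
  rw [← intervalIntegral.integral_add_adjacent_intervals (hcont.intervalIntegrable 0 x₀)
    (hcont.intervalIntegrable x₀ 1), hreflect]
  calc x₀ ^ s * (1 - x₀) ^ t / (s + t + 1)
      = x₀ ^ s * (1 - x₀) ^ t * (x₀ / (s + t + 1)) +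
          (1 - x₀) ^ t * x₀ ^ s * ((1 - x₀) / (t + s + 1)) := by
        rw [add_comm t s]
        ring
    _ < _ := add_lt_add hleft hright

theorem rpow_mul_one_sub_rpow_lt_Gamma_quotient {x₀ : ℝ} (hs : 0 < s) (ht : 0 < t) (h0 : 0 < x₀)
    (h1 : x₀ < 1) :
    x₀ ^ s * (1 - x₀) ^ t < Real.Gamma (s + 1) * Real.Gamma (t + 1) / Real.Gamma (s + t + 1) := by
  have := Real.Gamma_pos_of_pos (show 0 < s + t + 1 by positivity)
  have := Real.Gamma_pos_of_pos (show 0 < s + 1 by positivity)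
  have := Real.Gamma_pos_of_pos (show 0 < t + 1 by positivity)
  have hbeta := lintegral_rpow_mul_one_sub_rpow (s := s + 1) (t := t + 1) (by positivity)
    (by positivity)
  simp only [add_sub_cancel_right] at hbeta
  have hnonneg : 0 ≤ᵐ[volume.restrict (Ioo 0 1)] fun x : ℝ => x ^ s * (1 - x) ^ t :=
    ae_restrict_of_forall_mem measurableSet_Ioo fun x hx =>
      mul_nonneg (Real.rpow_nonneg hx.1.le s) (Real.rpow_nonneg (sub_nonneg.2 hx.2.le) t)
  have hlt := lt_integral_rpow_mul_one_sub_rpow hs ht h0 h1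
  rw [intervalIntegral.integral_of_le zero_le_one, integral_Ioc_eq_integral_Ioo,
    integral_eq_lintegral_of_nonneg_ae hnonneg
      (continuous_rpow_mul_one_sub_rpow hs.le ht.le).aestronglyMeasurable, hbeta,
    show s + 1 + (t + 1) = s + t + 1 + 1 by ring, Real.Gamma_add_one (s := s + t + 1)
      (by positivity), ENNReal.toReal_ofReal (by positivity), div_lt_iff₀ (by positivity)] at hlt
  refine hlt.trans_eq ?_
  field_simp

theorem mul_one_sub_le_one_sub_rpow {c w : ℝ} (hc0 : 0 ≤ c) (hc1 : c ≤ 1) (hw : 0 ≤ w) :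
    c * (1 - w) ≤ 1 - w ^ c := by
  have hbernoulli := rpow_one_add_le_one_add_mul_self (s := w - 1) (by linarith) hc0 hc1
  rw [add_sub_cancel] at hbernoulli
  linarith

theorem one_sub_rpow_le_mul_one_sub {c w : ℝ} (hc0 : 0 ≤ c) (hc1 : c ≤ 1) (hw : 0 < w) :
    1 - w ^ c ≤ c * (1 - w) * w ^ (c - 1) := by
  have hinv := mul_le_mul_of_nonneg_left (mul_one_sub_le_one_sub_rpow hc0 hc1 (inv_nonneg.2 hw.le))
    (Real.rpow_nonneg hw.le c)
  have hwc : w ^ c ≠ 0 := (Real.rpow_pos_of_pos hw c).ne'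
  have hright : w ^ c * (1 - w⁻¹ ^ c) = w ^ c - 1 := by
    rw [Real.inv_rpow hw.le, mul_sub, mul_one, mul_inv_cancel₀ hwc]
  have hleft : w ^ c * (c * (1 - w⁻¹)) = -(c * (1 - w) * w ^ (c - 1)) := by
    rw [Real.rpow_sub_one hw.ne']
    field_simp
    ring
  linarith

theorem rpow_mul_rpow_lt_one {c w r : ℝ} (hs : 0 < s) (hc : c < 1) (hw0 : 0 < w) (hw1 : w < 1)
    (hr1 : 1 ≤ r) (hr : r ≤ w ^ (c - 1)) : w ^ (s * (1 - c)) * r ^ (s - 1) < 1 := by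
  rcases le_total 1 s with h1s | hs1
  · calc w ^ (s * (1 - c)) * r ^ (s - 1)
        ≤ w ^ (s * (1 - c)) * (w ^ (c - 1)) ^ (s - 1) := by gcongr
      _ = w ^ (1 - c) := by
          rw [← Real.rpow_mul hw0.le, ← Real.rpow_add hw0]
          ring_nf
      _ < 1 := Real.rpow_lt_one hw0.le hw1 (sub_pos.2 hc)
  · calc w ^ (s * (1 - c)) * r ^ (s - 1) ≤ w ^ (s * (1 - c)) * 1 := by
          gcongr
          exact Real.rpow_le_one_of_one_le_of_nonpos hr1 (sub_nonpos.2 hs1)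
      _ < 1 := by
          rw [mul_one]
          exact Real.rpow_lt_one hw0.le hw1 (mul_pos hs (sub_pos.2 hc))

theorem rpow_substitution_lt {c w : ℝ} (hs : 0 < s) (hc0 : 0 < c) (hc1 : c < 1)
    (hc : c * (s + t + 1) = s + 1) (hw0 : 0 < w) (hw1 : w < 1) :
    c * w ^ (c - 1) * ((w ^ c) ^ t * (1 - w ^ c) ^ (s - 1)) < c ^ s * (1 - w) ^ (s - 1) := by
  have h1w : 0 < 1 - w := sub_pos.2 hw1
  have hcw : 0 < c * (1 - w) := mul_pos hc0 h1w
  obtain ⟨r, hr⟩ : ∃ r, 1 - w ^ c = r * (c * (1 - w)) := ⟨_, (div_mul_cancel₀ _ hcw.ne').symm⟩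
  have hr1 : 1 ≤ r := by
    refine le_of_mul_le_mul_right ?_ hcw
    rw [one_mul, ← hr]
    exact mul_one_sub_le_one_sub_rpow hc0.le hc1.le hw0.le
  have hrw : r ≤ w ^ (c - 1) := by
    refine le_of_mul_le_mul_right ?_ hcw
    rw [← hr, mul_comm]
    exact one_sub_rpow_le_mul_one_sub hc0.le hc1.le hw0
  have hr0 : 0 < r := one_pos.trans_le hr1
  calc c * w ^ (c - 1) * ((w ^ c) ^ t * (1 - w ^ c) ^ (s - 1))
      = w ^ (s * (1 - c)) * r ^ (s - 1) * (c ^ s * (1 - w) ^ (s - 1)) := by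
        rw [hr, Real.mul_rpow hr0.le hcw.le, Real.mul_rpow hc0.le h1w.le, ← Real.rpow_mul hw0.le,
          show s * (1 - c) = c - 1 + c * t by linarith, Real.rpow_add hw0,
          Real.rpow_sub_one hc0.ne']
        field_simp
    _ < c ^ s * (1 - w) ^ (s - 1) :=
        mul_lt_of_lt_one_left (by positivity) (rpow_mul_rpow_lt_one hs hc1 hw0 hw1 hr1 hrw)

theorem image_rpow_Ioo_zero_one {c : ℝ} (hc : 0 < c) :
    (fun w : ℝ => w ^ c) '' Ioo 0 1 = Ioo 0 1 := by
  ext y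
  constructor
  · rintro ⟨w, hw, rfl⟩
    exact ⟨Real.rpow_pos_of_pos hw.1 c, Real.rpow_lt_one hw.1.le hw.2 hc⟩
  · exact fun hy => ⟨y ^ c⁻¹, ⟨Real.rpow_pos_of_pos hy.1 _,
      Real.rpow_lt_one hy.1.le hy.2 (inv_pos.2 hc)⟩, Real.rpow_inv_rpow hy.1.le hc.ne'⟩

theorem lintegral_Ioo_comp_rpow {c : ℝ} (hc : 0 < c) (F : ℝ → ℝ≥0∞) :
    ∫⁻ w in Ioo (0 : ℝ) 1, ENNReal.ofReal (c * w ^ (c - 1)) * F (w ^ c) =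
      ∫⁻ x in Ioo (0 : ℝ) 1, F x := by
  conv_rhs => rw [← image_rpow_Ioo_zero_one hc]
  rw [lintegral_image_eq_lintegral_abs_deriv_mul measurableSet_Ioo
    (fun w hw => (Real.hasDerivAt_rpow_const (.inl (ne_of_gt hw.1))).hasDerivWithinAt)
    ((Real.rpow_left_injOn hc.ne').mono fun w hw => hw.1.le)]
  refine setLIntegral_congr_fun measurableSet_Ioo fun w hw => ?_
  have := hw.1
  rw [abs_of_pos (by positivity)]

/-- Substituting `x = w ^ c` in the Beta integral, with `c = (s + 1) / (s + t + 1)`, makes its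
integrand strictly smaller than `c ^ s * (1 - w) ^ (s - 1)`, whose integral is elementary. -/
theorem Gamma_quotient_lt_rpow (hs : 0 < s) (ht : 0 < t) :
    Real.Gamma (s + 1) * Real.Gamma (t + 1) / Real.Gamma (s + t + 1) <
      ((s + 1) / (s + t + 1)) ^ s := by
  obtain ⟨c, hcdef⟩ : ∃ c, c = (s + 1) / (s + t + 1) := ⟨_, rfl⟩
  have hc0 : 0 < c := by rw [hcdef]; positivity
  have hc1 : c < 1 := by rw [hcdef, div_lt_one (by positivity)]; linarith
  have hc : c * (s + t + 1) = s + 1 := by rw [hcdef]; field_simp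
  have hleft := lintegral_rpow_mul_one_sub_rpow (s := t + 1) (by positivity) hs
  have hright := lintegral_rpow_mul_one_sub_rpow one_pos hs
  simp only [add_sub_cancel_right] at hleft
  simp only [sub_self, Real.rpow_zero, one_mul, Real.Gamma_one, add_comm 1 s,
    Real.Gamma_add_one hs.ne'] at hright
  rw [← lintegral_Ioo_comp_rpow hc0] at hleft
  have hlt : ∫⁻ w in Ioo (0 : ℝ) 1, ENNReal.ofReal (c * w ^ (c - 1)) *
        ENNReal.ofReal ((w ^ c) ^ t * (1 - w ^ c) ^ (s - 1)) <
      ∫⁻ w in Ioo (0 : ℝ) 1, ENNReal.ofReal (c ^ s) * ENNReal.ofReal ((1 - w) ^ (s - 1)) := by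
    refine lintegral_strict_mono ?_ (by fun_prop) (hleft ▸ ENNReal.ofReal_ne_top) ?_
    · rw [Ne, Measure.restrict_eq_zero]
      simp
    · filter_upwards [ae_restrict_mem measurableSet_Ioo] with w ⟨hw0, hw1⟩
      have := sub_pos.2 hw1
      rw [← ENNReal.ofReal_mul (by positivity), ← ENNReal.ofReal_mul (by positivity)]
      exact (ENNReal.ofReal_lt_ofReal_iff (by positivity)).2
        (rpow_substitution_lt hs hc0 hc1 hc hw0 hw1)
  have := Real.Gamma_pos_of_pos hs
  rw [hleft, lintegral_const_mul _ (by fun_prop), hright, ← ENNReal.ofReal_mul (by positivity),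
    ENNReal.ofReal_lt_ofReal_iff (by positivity), show t + 1 + s = s + t + 1 by ring] at hlt
  calc Real.Gamma (s + 1) * Real.Gamma (t + 1) / Real.Gamma (s + t + 1)
      = s * (Real.Gamma (t + 1) * Real.Gamma s / Real.Gamma (s + t + 1)) := by
        rw [Real.Gamma_add_one hs.ne']
        ring
    _ < s * (c ^ s * (Real.Gamma s / (s * Real.Gamma s))) := mul_lt_mul_of_pos_left hlt hs
    _ = ((s + 1) / (s + t + 1)) ^ s := by
        rw [hcdef]
        field_simp

end GammaQuotient

section Strictness

variable {p q p' m γ n : ℝ} (e : BlissExponents p q p' m γ n)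
include e

theorem blissEnergy_eq_Gamma_quotient :
    blissEnergy p q = Real.Gamma (p / (q - p) + 1) * Real.Gamma (q * (p - 1) / (q - p) + 1) /
      Real.Gamma (p / (q - p) + q * (p - 1) / (q - p) + 1) := by
  have := e.q_sub_p_pos
  rw [blissEnergy]
  congr 3 <;> field_simp <;> ring

theorem sharpFactor_lt_roughFactor : sharpFactor p q < roughFactor p q := by
  have := e.p_pos
  have := e.q_pos
  have := e.p_sub_one_pos
  have := e.q_sub_p_pos
  have hconj : p.conjExponent = p / (p - 1) := rfl
  obtain ⟨s, hs⟩ : ∃ s, s = p / (q - p) := ⟨_, rfl⟩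
  obtain ⟨t, ht⟩ : ∃ t, t = q * (p - 1) / (q - p) := ⟨_, rfl⟩
  have hs0 : 0 < s := by rw [hs]; positivity
  have ht0 : 0 < t := by rw [ht]; positivity
  have hlt := rpow_mul_one_sub_rpow_lt_Gamma_quotient hs0 ht0 (x₀ := s / (s + t)) (by positivity)
    ((div_lt_one (by positivity)).2 (by linarith))
  rw [show 1 - s / (s + t) = t / (s + t) by field_simp; ring, hs, ht,
    ← blissEnergy_eq_Gamma_quotient e, ← hs, ← ht] at hlt
  have hexp : 0 < 1 / p - 1 / q := sub_pos.2 (one_div_lt_one_div_of_lt e.p_pos e.p_lt_q)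
  have hsexp : s * (1 / p - 1 / q) = 1 / q := by rw [hs]; field_simp
  have htexp : t * (1 / p - 1 / q) = 1 / p.conjExponent := by rw [ht, hconj]; field_simp
  have hsinv : 1 + q / p.conjExponent = (s / (s + t))⁻¹ := by
    rw [hconj, hs, ht]
    field_simp
  have htinv : 1 + p.conjExponent / q = (t / (s + t))⁻¹ := by
    rw [hconj, hs, ht]
    field_simp
    ring
  calc sharpFactor p q = blissEnergy p q ^ (-(1 / p - 1 / q)) := sharpFactor_eq_blissEnergy_rpow e
    _ < ((s / (s + t)) ^ s * (t / (s + t)) ^ t) ^ (-(1 / p - 1 / q)) :=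
        Real.rpow_lt_rpow_of_neg (by positivity) hlt (neg_lt_zero.2 hexp)
    _ = roughFactor p q := by
        rw [roughFactor, hsinv, htinv, Real.rpow_neg (by positivity),
          Real.mul_rpow (by positivity) (by positivity), ← Real.rpow_mul (by positivity),
          ← Real.rpow_mul (by positivity), hsexp, htexp, mul_inv, Real.inv_rpow (by positivity),
          Real.inv_rpow (by positivity)]

theorem rpow_lt_sharpFactor : p ^ (1 / q) < sharpFactor p q := by
  have := e.p_pos
  have := e.q_pos
  have := e.p_sub_one_pos
  have := e.q_sub_p_pos
  have hlt : blissEnergy p q < p⁻¹ ^ (p / (q - p)) := by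
    have hquot := Gamma_quotient_lt_rpow (s := p / (q - p)) (t := q * (p - 1) / (q - p))
      (by positivity) (by positivity)
    rwa [← blissEnergy_eq_Gamma_quotient e,
      show (p / (q - p) + 1) / (p / (q - p) + q * (p - 1) / (q - p) + 1) = p⁻¹ by
        field_simp; ring] at hquot
  have hexp : 0 < 1 / p - 1 / q := sub_pos.2 (one_div_lt_one_div_of_lt e.p_pos e.p_lt_q)
  calc p ^ (1 / q) = (p⁻¹ ^ (p / (q - p))) ^ (-(1 / p - 1 / q)) := by
        rw [← Real.rpow_mul (by positivity), Real.inv_rpow e.p_pos.le, ← Real.rpow_neg e.p_pos.le]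
        congr 1
        field_simp
    _ < blissEnergy p q ^ (-(1 / p - 1 / q)) :=
        Real.rpow_lt_rpow_of_neg (blissEnergy_pos e) hlt (neg_lt_zero.2 hexp)
    _ = sharpFactor p q := (sharpFactor_eq_blissEnergy_rpow e).symm

end Strictness

/-! ### Comparison of the constants -/

section Comparison

variable {p q p' m γ n : ℝ}

theorem hardyConst_conj_exponent (h : p.HolderConjugate p') (hq : 0 < q) :
    hardyConst (q / p' + 1) (q / p' + 1) (powerMeasure (q / p' + 1)) halfLebesgue =
      ENNReal.ofReal (p' / q + 1) := by
  have hqp' : 0 < q / p' := div_pos hq h.symm.pos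
  rw [hardyConst_powerMeasure_self (by linarith), add_sub_cancel_right, add_div,
    div_self hqp'.ne', one_div_div, add_comm]

theorem upperDelta_eq_hardyConst_rpow (h : p.HolderConjugate p') (hq : 0 < q) {k : ℕ}
    (hk : 1 ≤ k) :
    upperDelta p q (powerMeasure (q / p' + 1)) halfLebesgue k =
      hardyConst (q / p' + 1) (q / p' + 1) (powerMeasure (q / p' + 1)) halfLebesgue ^
        (1 / p' + 1 / q) := by
  have := div_pos h.symm.pos hq
  rw [upperDelta_powerMeasure h hq hk, hardyConst_conj_exponent h hq,
    ENNReal.ofReal_rpow_of_pos (by positivity), add_comm 1]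

theorem upperDelta_eq_roughFactor_mul_hardyB (h : p.HolderConjugate p') (hq : 0 < q) {k : ℕ}
    (hk : 1 ≤ k) :
    upperDelta p q (powerMeasure (q / p' + 1)) halfLebesgue k =
      ENNReal.ofReal (roughFactor p q) * hardyB p q (powerMeasure (q / p' + 1)) halfLebesgue := by
  have hp' := h.symm.pos
  rw [upperDelta_powerMeasure h hq hk, hardyB_powerMeasure h hq, roughFactor, h.conjExponent_eq,
    ← ENNReal.ofReal_mul (by positivity), mul_right_comm,
    ← Real.mul_rpow (by positivity) (by positivity),
    show (1 + q / p') * (p' / q) = 1 + p' / q by field_simp; ring,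
    ← Real.rpow_add (by positivity), add_comm (1 / q)]

theorem lowerDelta1_eq_rpow_mul_hardyB (h : p.HolderConjugate p') (hq : 0 < q) :
    lowerDelta1 p q (powerMeasure (q / p' + 1)) halfLebesgue =
      ENNReal.ofReal (p ^ (1 / q)) * hardyB p q (powerMeasure (q / p' + 1)) halfLebesgue := by
  have hp := h.pos
  have hp' := h.symm.pos
  rw [lowerDelta1_powerMeasure h hq, hardyB_powerMeasure h hq,
    ← ENNReal.ofReal_mul (by positivity), ← Real.mul_rpow hp.le (by positivity), mul_div_assoc]

theorem ofReal_mul_hardyB_lt (h : p.HolderConjugate p') (hq : 0 < q) {a b : ℝ} (hb : 0 < b)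
    (hab : a < b) :
    ENNReal.ofReal a * hardyB p q (powerMeasure (q / p' + 1)) halfLebesgue <
      ENNReal.ofReal b * hardyB p q (powerMeasure (q / p' + 1)) halfLebesgue := by
  have := div_pos h.symm.pos hq
  rw [hardyB_powerMeasure h hq]
  exact ENNReal.mul_lt_mul_left (ENNReal.ofReal_pos.2 (by positivity)).ne' ENNReal.ofReal_ne_top
    ((ENNReal.ofReal_lt_ofReal_iff hb).2 hab)

theorem hardyB_lt_lowerDelta1 (h : p.HolderConjugate p') (hq : 0 < q) :
    hardyB p q (powerMeasure (q / p' + 1)) halfLebesgue <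
      lowerDelta1 p q (powerMeasure (q / p' + 1)) halfLebesgue := by
  have hlt := ofReal_mul_hardyB_lt h hq (Real.rpow_pos_of_pos h.pos (1 / q))
    (Real.one_lt_rpow h.lt (one_div_pos.2 hq))
  rwa [ENNReal.ofReal_one, one_mul, ← lowerDelta1_eq_rpow_mul_hardyB h hq] at hlt

theorem hardyConst_eq_sharpFactor_mul_hardyB (e : BlissExponents p q p' m γ n) :
    hardyConst p q (powerMeasure m) halfLebesgue =
      ENNReal.ofReal (sharpFactor p q) * hardyB p q (powerMeasure m) halfLebesgue := by
  rw [hardyConst_powerMeasure e, e.m_eq, hardyB_powerMeasure e.holderConjugate e.q_pos,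
    ← ENNReal.ofReal_mul (sharpFactor_pos e).le, mul_comm]

theorem sharpFactor_mul_hardyB_lt_upperDelta (e : BlissExponents p q p' m γ n) {k : ℕ}
    (hk : 1 ≤ k) :
    ENNReal.ofReal (sharpFactor p q) * hardyB p q (powerMeasure m) halfLebesgue <
      upperDelta p q (powerMeasure m) halfLebesgue k := by
  rw [e.m_eq, upperDelta_eq_roughFactor_mul_hardyB e.holderConjugate e.q_pos hk]
  exact ofReal_mul_hardyB_lt e.holderConjugate e.q_pos
    ((sharpFactor_pos e).trans (sharpFactor_lt_roughFactor e)) (sharpFactor_lt_roughFactor e)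

theorem lowerDelta1_lt_hardyConst (e : BlissExponents p q p' m γ n) :
    lowerDelta1 p q (powerMeasure m) halfLebesgue <
      hardyConst p q (powerMeasure m) halfLebesgue := by
  rw [hardyConst_eq_sharpFactor_mul_hardyB e, e.m_eq,
    lowerDelta1_eq_rpow_mul_hardyB e.holderConjugate e.q_pos]
  exact ofReal_mul_hardyB_lt e.holderConjugate e.q_pos (sharpFactor_pos e) (rpow_lt_sharpFactor e)

end Comparison

end Bliss

theorem mainTheorem7 (p q : ℝ) (hp : 1 < p) (hpq : p < q) :
    -- the optimal constant: the supremum of the quotients is the least admissible constant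
    IsLeast {C : ℝ≥0∞ | HardyIneq p q (blissMeasure p q) halfLebesgue C}
      (hardyConst p q (blissMeasure p q) halfLebesgue) ∧
    hardyConst p q (blissMeasure p q) halfLebesgue =
      ENNReal.ofReal ((p.conjExponent / q) ^ (1 / q) * sharpFactor p q) ∧
    hardyB p q (blissMeasure p q) halfLebesgue =
      ENNReal.ofReal ((p.conjExponent / q) ^ (1 / q)) ∧
    hardyConst p q (blissMeasure p q) halfLebesgue =
      ENNReal.ofReal (sharpFactor p q) * hardyB p q (blissMeasure p q) halfLebesgue ∧
    -- the optimizers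
    (∀ α β : ℝ, 0 < α → 0 < β →
      blissFun p q α β ∈ HardyAC0 ∧
      (∀ x : ℝ, 0 < x → HasDerivAt (blissFun p q α β)
        (α / (β * x ^ (q / p - 1) + 1) ^ ((q / p - 1 + 1) / (q / p - 1))) x) ∧
      0 < eLpNorm (deriv (blissFun p q α β)) (ENNReal.ofReal p) halfLebesgue ∧
      eLpNorm (deriv (blissFun p q α β)) (ENNReal.ofReal p) halfLebesgue < ∞ ∧
      eLpNorm (blissFun p q α β) (ENNReal.ofReal q) (blissMeasure p q) =
        hardyConst p q (blissMeasure p q) halfLebesgue *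
          eLpNorm (deriv (blissFun p q α β)) (ENNReal.ofReal p) halfLebesgue) ∧
    -- the upper bounds
    (∀ n : ℕ, 1 ≤ n →
      upperDelta p q (blissMeasure p q) halfLebesgue n =
        ENNReal.ofReal
          ((1 + p.conjExponent / q) ^ (1 / p.conjExponent + 1 / q)) ∧
      upperDelta p q (blissMeasure p q) halfLebesgue n =
        ENNReal.ofReal (roughFactor p q) * hardyB p q (blissMeasure p q) halfLebesgue ∧
      ENNReal.ofReal (sharpFactor p q) * hardyB p q (blissMeasure p q) halfLebesgue <
        upperDelta p q (blissMeasure p q) halfLebesgue n ∧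
      upperDelta p q (blissMeasure p q) halfLebesgue n =
        hardyConst (q / p.conjExponent + 1) (q / p.conjExponent + 1)
          (blissMeasure p q) halfLebesgue ^ (1 / p.conjExponent + 1 / q)) ∧
    hardyConst (q / p.conjExponent + 1) (q / p.conjExponent + 1)
      (blissMeasure p q) halfLebesgue = ENNReal.ofReal (p.conjExponent / q + 1) ∧
    -- the lower bound
    lowerDelta1 p q (blissMeasure p q) halfLebesgue =
      ENNReal.ofReal ((p * p.conjExponent / q) ^ (1 / q)) ∧
    lowerDelta1 p q (blissMeasure p q) halfLebesgue =
      ENNReal.ofReal (p ^ (1 / q)) * hardyB p q (blissMeasure p q) halfLebesgue ∧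
    hardyB p q (blissMeasure p q) halfLebesgue <
      lowerDelta1 p q (blissMeasure p q) halfLebesgue ∧
    lowerDelta1 p q (blissMeasure p q) halfLebesgue <
      hardyConst p q (blissMeasure p q) halfLebesgue := by
  have e := BlissExponents.of_lt hp hpq
  have h := e.holderConjugate
  have hq := e.q_pos
  rw [blissMeasure_eq_powerMeasure]
  exact ⟨isLeast_hardyConst_powerMeasure e, hardyConst_powerMeasure e, hardyB_powerMeasure h hq,
    hardyConst_eq_sharpFactor_mul_hardyB e,
    fun α β hα hβ => ⟨blissFun_mem_HardyAC0 e hα hβ, fun _ => hasDerivAt_blissFun e hβ,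
      eLpNorm_deriv_blissFun_pos e hα hβ, eLpNorm_deriv_blissFun_lt_top e hα hβ,
      eLpNorm_blissFun_eq_hardyConst_mul e hα hβ⟩,
    fun n hn => ⟨upperDelta_powerMeasure h hq hn, upperDelta_eq_roughFactor_mul_hardyB h hq hn,
      sharpFactor_mul_hardyB_lt_upperDelta e hn, upperDelta_eq_hardyConst_rpow h hq hn⟩,
    hardyConst_conj_exponent h hq, lowerDelta1_powerMeasure h hq,
    lowerDelta1_eq_rpow_mul_hardyB h hq, hardyB_lt_lowerDelta1 h hq, lowerDelta1_lt_hardyConst e⟩
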